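/- Let $d\ge 1$. For each integer $n\ge d$ let $n_1,\dots,n_d$ be positive integers (depending on $n$) with $n_1+\dots+n_d=n$, and suppose that $n_\delta/n\to\alpha_\delta$ as $n\to\infty$ for every $\delta\in\{1,\dots,d\}$. Put $A=\operatorname{diag}(\alpha_1,\dots,\alpha_d)$ and $\sqrt A=\operatorname{diag}(\sqrt{\alpha_1},\dots,\sqrt{\alpha_d})$. Let $J$ be a real $d\times d$ matrix and let $X^{(n)}=(X^{(n)}_{\delta i})_{1\le\delta\le d,\,1\le i\le n_\delta}$, $n\ge d$, be $\{\pm1\}$-valued random variables distributed according to the multi-group Curie–Weiss model with coupling matrix $J$, i.e. \[ \mathbb P\bigl(X^{(n)}_{\delta i}=x_{\delta i}\ \text{for all }\delta,i\bigr)\ \propto\ \exp\Bigl(\frac1{2n}\sum_{\delta,\gamma=1}^d J_{\delta\gamma}\sum_{i=1}^{n_\delta}\sum_{j=1}^{n_\gamma}x_{\delta i}x_{\gamma j}\Bigr),\qquad x_{\delta i}\in\{-1,1\}. \] Assume that $J$ lies in the high-temperature regime, i.e. that one of the following holds: (homogeneous case) all entries of $J$ equal a constant $\beta\in[0,1)$;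 in this case let $C=I_d+\sqrt A\,\bigl(\tfrac{\beta}{1-\beta}\bigr)_{d\times d}\sqrt A$, where $(t)_{d\times d}$ is the $d\times d$ matrix with all entries equal to $t$; (heterogeneous case) $J$ is symmetric positive definite and $J^{-1}-A$ is positive definite; in this case let $C=I_d+\sqrt A\,(J^{-1}-A)^{-1}\sqrt A$. Let \[ S_n^*=\Bigl(\frac1{\sqrt{n_1}}\sum_{i=1}^{n_1}X^{(n)}_{1i},\ \dots,\ \frac1{\sqrt{n_d}}\sum_{i=1}^{n_d}X^{(n)}_{di}\Bigr), \] let $a,b\in\mathbb R^d$ with $a_\delta<b_\delta$ for all $\delta$, and let $(m(n))_n$ be a sequence in $\mathbb R^d$ with $m_\delta(n)\sqrt{n_\delta}\to\infty$ as $n\to\infty$ for every $\delta$. Then \[ \sup_{I\in\mathcal I_{m(n)}([a,b])}\left|\frac{\mathbb P(S_n^*\in I)}{\mathcal N(0,C)(I)}-1\right|\ \xrightarrow[n\to\infty]{}\ 0 , \] where $[a,b]=\prod_\delta[a_\delta,b_\delta]$, $\mathcal N(0,C)$ is the centred normal distribution on $\mathbb R^d$ with covariance matrix $C$, and $\mathcal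 I_{c}([a,b])$ is the set of all products $I=I_1\times\dots\times I_d\subseteq[a,b]$ of real intervals $I_\delta$ (open, half-open or closed) of length at least $c_\delta$; the supremum over the empty set is $0$. -/

import Mathlib

open MeasureTheory ProbabilityTheory Filter
open scoped Topology ENNReal Matrix

noncomputable section

namespace CurieWeiss

variable {d : ℕ}

/-- Spin configurations of `d` groups, the group `δ` consisting of `N δ` spins.
The spin values are the elements `1` and `-1` of `ℤˣ`. -/
abbrev SpinConfig (N : Fin d → ℕ) : Type := (Σ δ : Fin d, Fin (N δ)) → ℤˣ

/-- The value `± 1`, as a real number, of the `i`-th spin of the group `δ`. -/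
def spin {N : Fin d → ℕ} (x : SpinConfig N) (δ : Fin d) (i : Fin (N δ)) : ℝ :=
  ((x ⟨δ, i⟩ : ℤ) : ℝ)

/-- The unnormalised weight
`exp (1 / (2 n) * ∑ δ γ, J δ γ * ∑ i j, x δ i * x γ j)` with `n = ∑ δ, N δ`. -/
def weight (J : Matrix (Fin d) (Fin d) ℝ) (N : Fin d → ℕ) (x : SpinConfig N) : ℝ :=
  Real.exp (1 / (2 * ((∑ δ, N δ : ℕ) : ℝ)) *
    ∑ δ, ∑ γ, J δ γ * ∑ i : Fin (N δ), ∑ j : Fin (N γ), spin x δ i * spin x γ j)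

/-- The normalising constant of the multi-group Curie-Weiss model. -/
def partitionFunction (J : Matrix (Fin d) (Fin d) ℝ) (N : Fin d → ℕ) : ℝ :=
  ∑ x : SpinConfig N, weight J N x

/-- The multi-group Curie-Weiss distribution with coupling matrix `J` and group sizes `N`. -/
def curieWeissMeasure (J : Matrix (Fin d) (Fin d) ℝ) (N : Fin d → ℕ) : Measure (SpinConfig N) :=
  ∑ x : SpinConfig N,
    ENNReal.ofReal (weight J N x / partitionFunction J N) • Measure.dirac x

/-- The vector of rescaled group magnetizations, `(1 / √(N δ)) * ∑ i, x δ i` for each `δ`. -/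
def rescaledMagnetization {N : Fin d → ℕ} (x : SpinConfig N) : EuclideanSpace ℝ (Fin d) :=
  WithLp.toLp 2 fun δ => 1 / √(N δ : ℝ) * ∑ i : Fin (N δ), spin x δ i

/-- `A = diag (α 1, ..., α d)`. -/
def fractionMatrix (α : Fin d → ℝ) : Matrix (Fin d) (Fin d) ℝ :=
  Matrix.diagonal α

/-- `√A = diag (√(α 1), ..., √(α d))`. -/
def sqrtFractionMatrix (α : Fin d → ℝ) : Matrix (Fin d) (Fin d) ℝ :=
  Matrix.diagonal fun δ => √(α δ)

/-- The matrix all of whose entries are equal to `β`. -/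
def constMatrix (d : ℕ) (β : ℝ) : Matrix (Fin d) (Fin d) ℝ :=
  Matrix.of fun _ _ => β

/-- The pairs `(J, C)` of a coupling matrix in the high-temperature regime, for asymptotic group
fractions `α`, and of the covariance matrix of the limiting normal distribution. -/
inductive HighTemperature (α : Fin d → ℝ) :
    Matrix (Fin d) (Fin d) ℝ → Matrix (Fin d) (Fin d) ℝ → Prop
  | homogeneous (β : ℝ) (hβ : 0 ≤ β) (hβ' : β < 1) :
      HighTemperature α (constMatrix d β)
        (1 + sqrtFractionMatrix α * constMatrix d (β / (1 - β)) * sqrtFractionMatrix α)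
  | heterogeneous (J : Matrix (Fin d) (Fin d) ℝ) (hJ : J.PosDef)
      (hJα : (J⁻¹ - fractionMatrix α).PosDef) :
      HighTemperature α J
        (1 + sqrtFractionMatrix α * (J⁻¹ - fractionMatrix α)⁻¹ * sqrtFractionMatrix α)

/-- The compact `d`-dimensional interval `[a, b]`. -/
def closedBox (a b : Fin d → ℝ) : Set (EuclideanSpace ℝ (Fin d)) :=
  {x | ∀ δ, a δ ≤ x δ ∧ x δ ≤ b δ}

/-- The `d`-dimensional intervals `I = ∏ δ, K δ` contained in `M` such that the length of the
(open, half-open or closed) real interval `K δ` is at least `c δ`, for each `δ`. -/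
def intervalsIn (c : Fin d → ℝ) (M : Set (EuclideanSpace ℝ (Fin d))) :
    Set (Set (EuclideanSpace ℝ (Fin d))) :=
  {I | I ⊆ M ∧ ∃ K : Fin d → Set ℝ,
    (∀ δ, (K δ).OrdConnected ∧ ENNReal.ofReal (c δ) ≤ volume (K δ)) ∧
    I = {x | ∀ δ, x δ ∈ K δ}}

end CurieWeiss

end

namespace CurieWeiss

/-! The weight of a configuration depends only on the numbers `k δ` of spins `1`. After division by
the number of configurations, a count vector has weight `latticeWeight`: a product of fair binomial
probabilities times the exponential of half a quadratic form in the rescaled magnetizations, which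
live on a lattice with spacings `2 / √(N δ)`.

Stirling's formula gives a local limit theorem, uniform on bounded sets
(`tendsto_sqrt_mul_fairWeight`, `tendsto_latticeWeight_sub`): divided by the cell volume,
`latticeWeight` is close to a constant times `limitDensity`. The group fractions tend to `α`, and
the inverse of `C` is `1 - √A * J * √A` (`HighTemperature.mul_eq_one`), so the limiting
`limitDensity` is an unnormalised density of the Gaussian with covariance `C`.

The mass of a box is thus a Riemann sum. It is written as the integral of a step function and
rescaled to the unit cube; since the sides of the box are long compared to the lattice spacing,
dominated convergence applies (`tendsto_latticeMass_div_sub`). On bounded sets the density is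
bounded below, so the relative error vanishes too, even for shrinking boxes. The normalising
constant needs a tail bound (`latticeMass_univ_le`): high temperature makes the quadratic form at
most `(1 - c) * ∑ x δ ^ 2` in the limit, and binomial moments of `exp (θ x ^ 2 / 2)` are bounded
uniformly for `θ < 1`.

Uniformity over boxes follows by contradiction: choose one violating box for each `n` that has any,
and apply the convergence along these `n`. -/

/-! ### Fair binomial weights of a single group: local limit and exponential moments -/

/-- The value `(2 k - N) / √N` of the rescaled magnetization of a group of `N` spins, `k` of which
are equal to `1`. -/
noncomputable def latticePoint (N k : ℕ) : ℝ := (2 * k - N) / √(N : ℝ)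

/-- The probability that exactly `k` out of `N` independent fair spins are equal to `1`. -/
noncomputable def fairWeight (N k : ℕ) : ℝ := N.choose k / 2 ^ N

theorem fairWeight_nonneg (N k : ℕ) : 0 ≤ fairWeight N k := by
  unfold fairWeight; positivity

/-- The entropy function `(1 + u) log (1 + u) + (1 - u) log (1 - u)` is `u ^ 2 + O (u ^ 3)`. -/
theorem abs_entropy_sub_sq_le {u : ℝ} (hu : |u| ≤ 1 / 2) :
    |(1 + u) * Real.log (1 + u) + (1 - u) * Real.log (1 - u) - u ^ 2| ≤ 8 * |u| ^ 3 := by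
  have h1 := Real.abs_log_sub_add_sum_range_le (x := u) (by linarith) 2
  have h2 := Real.abs_log_sub_add_sum_range_le (x := -u) (by rw [abs_neg]; linarith) 2
  simp only [Finset.sum_range_succ, Finset.sum_range_zero, sub_neg_eq_add, abs_neg] at h1 h2
  norm_num at h1 h2
  have hb : |u| ^ 3 / (1 - |u|) ≤ 2 * |u| ^ 3 := by
    rw [div_le_iff₀ (by linarith)]
    have : 0 ≤ |u| ^ 3 := by positivity
    nlinarith
  have h1' := abs_le.1 (h1.trans hb)
  have h2' := abs_le.1 (h2.trans hb)
  have hu' := abs_le.1 hu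
  set e1 := u + u ^ 2 / 2 + Real.log (1 - u) with he1
  set e2 := -u + u ^ 2 / 2 + Real.log (1 + u) with he2
  have key : (1 + u) * Real.log (1 + u) + (1 - u) * Real.log (1 - u) - u ^ 2 =
      (1 + u) * e2 + (1 - u) * e1 := by
    rw [he1, he2]; ring
  have hc : 0 ≤ |u| ^ 3 := by positivity
  rw [key, abs_le]
  constructor <;> nlinarith

/-- The Stirling approximation of `k !` as a multiplicative identity. -/
theorem factorial_eq_stirlingSeq_mul {n : ℕ} (hn : n ≠ 0) :
    (n.factorial : ℝ) = Stirling.stirlingSeq n * (√(2 * n) * (n / Real.exp 1) ^ n) := by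
  have : 0 < √(2 * n : ℝ) * (n / Real.exp 1) ^ n := by positivity
  rw [Stirling.stirlingSeq, div_mul_cancel₀ _ this.ne']

theorem pow_eq_exp_mul_log {x : ℝ} (hx : 0 < x) (n : ℕ) : x ^ n = Real.exp (n * Real.log x) := by
  rw [mul_comm, Real.exp_mul, Real.exp_log hx, Real.rpow_natCast]

/-- With `u = (2 k - N) / N` one has `k = N (1 + u) / 2` and `N - k = N (1 - u) / 2`. Writing the
three factorials through `Stirling.stirlingSeq`, the powers combine to the entropy of `u` and the
square roots to `√(1 - u ^ 2)`. No error term arises here. -/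
theorem sqrt_div_two_mul_fairWeight_mul_exp {N k : ℕ} (hk : 0 < k) (hkN : k < N) :
    √(N : ℝ) / 2 * fairWeight N k * Real.exp (latticePoint N k ^ 2 / 2) =
      Stirling.stirlingSeq N / (Stirling.stirlingSeq k * Stirling.stirlingSeq (N - k)) *
      (1 / √2 * (1 / √(1 - ((2 * k - N) / N : ℝ) ^ 2))) *
      Real.exp (-(N / 2) * ((1 + ((2 * k - N) / N : ℝ)) * Real.log (1 + (2 * k - N) / N) +
        (1 - ((2 * k - N) / N : ℝ)) * Real.log (1 - (2 * k - N) / N) -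
          ((2 * k - N) / N : ℝ) ^ 2)) := by
  obtain ⟨j, rfl⟩ : ∃ j, N = k + j := ⟨N - k, by omega⟩
  have hj : 0 < j := by omega
  have hkr : (0 : ℝ) < k := by exact_mod_cast hk
  have hjr : (0 : ℝ) < j := by exact_mod_cast hj
  have hsum : (0 : ℝ) < k + j := by positivity
  have e1 : (1 + (2 * k - (k + j : ℕ)) / (k + j : ℕ) : ℝ) = 2 * k / (k + j) := by
    push_cast; field_simp; ring
  have e2 : (1 - (2 * k - (k + j : ℕ)) / (k + j : ℕ) : ℝ) = 2 * j / (k + j) := by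
    push_cast; field_simp; ring
  have e3 : (1 - ((2 * k - (k + j : ℕ)) / (k + j : ℕ) : ℝ) ^ 2) =
      4 * (k * j) / (k + j) ^ 2 := by
    push_cast; field_simp; ring
  have e4 : latticePoint (k + j) k ^ 2 / 2 =
    (k + j) / 2 * ((2 * k - (k + j : ℕ)) / (k + j : ℕ) : ℝ) ^ 2 := by
    rw [latticePoint, div_pow, Real.sq_sqrt (by positivity)]
    push_cast; field_simp
  rw [e1, e2, e3, e4, fairWeight, Nat.choose_symm_add, Nat.add_choose,
    Nat.cast_div (Nat.factorial_mul_factorial_dvd_factorial_add k j) (by positivity), Nat.add_sub_cancel_left]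
  push_cast
  rw [factorial_eq_stirlingSeq_mul hk.ne', factorial_eq_stirlingSeq_mul hj.ne',
    factorial_eq_stirlingSeq_mul (by omega : k + j ≠ 0)]
  have s1 : 0 < Stirling.stirlingSeq k := by
    obtain ⟨m, rfl⟩ : ∃ m, k = m + 1 := ⟨k - 1, by omega⟩
    exact Stirling.stirlingSeq'_pos m
  have s2 : 0 < Stirling.stirlingSeq j := by
    obtain ⟨m, rfl⟩ : ∃ m, j = m + 1 := ⟨j - 1, by omega⟩
    exact Stirling.stirlingSeq'_pos m
  have hexp : Real.exp (-(((k:ℝ) + j) / 2) * (2 * k / (k + j) * Real.log (2 * k / (k + j)) +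
      2 * j / (k + j) * Real.log (2 * j / (k + j)) - ((2 * k - (k + j)) / (k + j) : ℝ) ^ 2)) =
      Real.exp ((k + j) / 2 * ((2 * k - (k + j)) / (k + j) : ℝ) ^ 2) *
      ((2 * k / (k + j)) ^ k * (2 * j / (k + j)) ^ j : ℝ)⁻¹ := by
    rw [pow_eq_exp_mul_log (x := 2 * k / (k + j)) (by positivity) k,
      pow_eq_exp_mul_log (x := 2 * j / (k + j)) (by positivity) j, ← Real.exp_add,
      ← Real.exp_neg, ← Real.exp_add]
    congr 1
    field_simp
    ring
  rw [hexp]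
  have r1 : √(4 * (k * j) / (k + j) ^ 2 : ℝ) = 2 * (√k * √j) / (k + j) := by
    rw [Real.sqrt_div (by positivity), Real.sqrt_sq hsum.le, Real.sqrt_mul (by norm_num),
      Real.sqrt_mul hkr.le, show (4 : ℝ) = 2 ^ 2 by norm_num, Real.sqrt_sq (by norm_num)]
  rw [r1]
  push_cast
  rw [Real.sqrt_mul zero_le_two, Real.sqrt_mul zero_le_two, Real.sqrt_mul zero_le_two]
  have q1 : 0 < √(k + j : ℝ) := Real.sqrt_pos.2 hsum
  have q2 : 0 < √(k : ℝ) := Real.sqrt_pos.2 hkr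
  have q3 : 0 < √(j : ℝ) := Real.sqrt_pos.2 hjr
  have q4 : 0 < √(2 : ℝ) := by positivity
  simp only [div_pow, mul_pow, pow_add]
  set E := Real.exp ((k + j) / 2 * ((2 * k - (k + j)) ^ 2 / (k + j) ^ 2 : ℝ))
  field_simp
  simp only [Real.sq_sqrt hsum.le]

/-- De Moivre–Laplace: boundedness of the lattice point means `u = O (1 / √N)`, so `N` times the
cubic entropy error is `O (1 / √N)`, while the Stirling factors tend to `1 / √π`. The filter is
arbitrary so that ultrafilters are allowed later. -/
theorem tendsto_sqrt_mul_fairWeight {ι : Type*} {l : Filter ι} {N k : ι → ℕ} {R : ℝ}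
    (hN : Tendsto N l atTop) (hk : ∀ᶠ i in l, |latticePoint (N i) (k i)| ≤ R) :
    Tendsto (fun i => √(N i : ℝ) / 2 * fairWeight (N i) (k i) *
      Real.exp (latticePoint (N i) (k i) ^ 2 / 2)) l (𝓝 (1 / √(2 * Real.pi))) := by
  have hNr : Tendsto (fun i => (N i : ℝ)) l atTop := tendsto_natCast_atTop_atTop.comp hN
  have hNs : Tendsto (fun i => √(N i : ℝ)) l atTop := Real.tendsto_sqrt_atTop.comp hNr
  set u : ι → ℝ := fun i => (2 * k i - N i) / N i with hu
  have hub : ∀ᶠ i in l, |u i| ≤ |R| / √(N i) := by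
    filter_upwards [hk, hNr.eventually_gt_atTop 0] with i hi h0
    have : u i = latticePoint (N i) (k i) / √(N i) := by
      rw [hu, latticePoint, div_div, Real.mul_self_sqrt h0.le]
    rw [this, abs_div, abs_of_nonneg (Real.sqrt_nonneg _)]
    exact div_le_div_of_nonneg_right (hi.trans (le_abs_self R)) (Real.sqrt_nonneg _)
  have hu0 : Tendsto u l (𝓝 0) :=
    squeeze_zero_norm' (by simpa using hub) (hNs.const_div_atTop |R|)
  have hu2 : ∀ᶠ i in l, |u i| < 1 / 2 := by
    simpa using hu0.eventually (Metric.ball_mem_nhds 0 (by norm_num : (0 : ℝ) < 1 / 2))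
  have hkeq : ∀ᶠ i in l, (k i : ℝ) = N i / 2 * (1 + u i) := by
    filter_upwards [hNr.eventually_gt_atTop 0] with i h0
    rw [hu]; field_simp; ring
  have hk0 : ∀ᶠ i in l, 0 < k i ∧ k i < N i := by
    filter_upwards [hu2, hNr.eventually_gt_atTop 0, hkeq] with i h1 h0 h2
    have := abs_lt.1 h1
    constructor
    · have : (0 : ℝ) < k i := by rw [h2]; nlinarith
      exact_mod_cast this
    · have : (k i : ℝ) < N i := by rw [h2]; nlinarith
      exact_mod_cast this
  have hkt : Tendsto k l atTop := by
    rw [← tendsto_natCast_atTop_iff (R := ℝ)]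
    refine tendsto_atTop_mono' l ?_ (hNr.atTop_div_const (by norm_num : (0 : ℝ) < 4))
    filter_upwards [hu2, hNr.eventually_gt_atTop 0, hkeq] with i h1 h0 h2
    have := abs_lt.1 h1
    rw [h2]; nlinarith
  have hkt' : Tendsto (fun i => N i - k i) l atTop := by
    rw [← tendsto_natCast_atTop_iff (R := ℝ)]
    refine tendsto_atTop_mono' l ?_ (hNr.atTop_div_const (by norm_num : (0 : ℝ) < 4))
    filter_upwards [hu2, hNr.eventually_gt_atTop 0, hkeq, hk0] with i h1 h0 h2 h3
    have := abs_lt.1 h1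
    rw [Nat.cast_sub h3.2.le, h2]; nlinarith
  have hS := Stirling.tendsto_stirlingSeq_sqrt_pi
  have hpi : 0 < √Real.pi := Real.sqrt_pos.2 Real.pi_pos
  have t1 := (hS.comp hN).div ((hS.comp hkt).mul (hS.comp hkt')) (by positivity)
  have t2 : Tendsto (fun i => 1 / √2 * (1 / √(1 - u i ^ 2))) l (𝓝 (1 / √2 * (1 / √(1 - 0 ^ 2)))) := by
    have : ContinuousAt (fun v : ℝ => 1 / √2 * (1 / √(1 - v ^ 2))) 0 := by
      refine ContinuousAt.mul (by fun_prop) (ContinuousAt.div (by fun_prop) (by fun_prop) (by simp))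
    exact this.tendsto.comp hu0
  have t3 : Tendsto (fun i => -(N i / 2) * ((1 + u i) * Real.log (1 + u i) +
      (1 - u i) * Real.log (1 - u i) - u i ^ 2)) l (𝓝 0) := by
    refine squeeze_zero_norm' (a := fun i => 4 * |R| ^ 3 / √(N i)) ?_ (hNs.const_div_atTop _)
    filter_upwards [hu2, hub, hNr.eventually_gt_atTop 0] with i h1 h2 h0
    rw [Real.norm_eq_abs, abs_mul, abs_neg, abs_of_nonneg (by positivity : (0 : ℝ) ≤ N i / 2)]
    have hs : 0 < √(N i : ℝ) := Real.sqrt_pos.2 h0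
    calc _ ≤ (N i / 2 : ℝ) * (8 * (|R| / √(N i)) ^ 3) := by
          gcongr
          exact (abs_entropy_sub_sq_le h1.le).trans (by gcongr)
      _ = _ := by
          field_simp
          rw [Real.sq_sqrt h0.le]; ring
  have := (t1.mul t2).mul (Real.continuous_exp.tendsto 0 |>.comp t3)
  have hlim : √Real.pi / (√Real.pi * √Real.pi) * (1 / √2 * (1 / √(1 - 0 ^ 2))) * Real.exp 0 =
      1 / √(2 * Real.pi) := by
    rw [Real.sqrt_mul zero_le_two]
    simp [field]
  rw [hlim] at this
  refine this.congr' ?_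
  filter_upwards [hk0] with i hi
  exact (sqrt_div_two_mul_fairWeight_mul_exp hi.1 hi.2).symm

/-- The central binomial coefficient is the largest, and for it the local limit theorem gives a
convergent, hence bounded, sequence. -/
theorem exists_sqrt_mul_fairWeight_le : ∃ B : ℝ, 0 < B ∧ ∀ N k : ℕ, √(N : ℝ) / 2 * fairWeight N k ≤ B := by
  have hb : ∀ᶠ N : ℕ in atTop, |latticePoint N (N / 2)| ≤ 1 := by
    filter_upwards [eventually_gt_atTop 0] with N hN
    have h1 : (2 * (N / 2 : ℕ) : ℝ) ≤ N := by exact_mod_cast Nat.mul_div_le N 2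
    have h2 : (N : ℝ) ≤ 2 * (N / 2 : ℕ) + 1 := by norm_cast; omega
    have h3 : 1 ≤ √(N : ℝ) := by rw [Real.one_le_sqrt]; exact_mod_cast hN
    rw [latticePoint, abs_div, abs_of_nonneg (Real.sqrt_nonneg _), div_le_one (by linarith), abs_le]
    constructor <;> linarith
  obtain ⟨B, hB⟩ := (tendsto_sqrt_mul_fairWeight tendsto_id hb).bddAbove_range
  refine ⟨max B 1, by positivity, fun N k => le_trans ?_ (le_max_left _ _)⟩
  refine le_trans ?_ (hB ⟨N, rfl⟩)
  have h0 : √(N : ℝ) / 2 * fairWeight N k ≤ √(N : ℝ) / 2 * fairWeight N (N / 2) := by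
    unfold fairWeight
    gcongr
    exact Nat.choose_le_middle k N
  refine h0.trans (le_mul_of_one_le_right (mul_nonneg (by positivity) (fairWeight_nonneg _ _)) ?_)
  exact Real.one_le_exp (by positivity)

theorem sum_fairWeight_mul_exp (N : ℕ) (t : ℝ) :
    ∑ k ∈ Finset.range (N + 1), fairWeight N k * Real.exp (t * (2 * k - N)) = Real.cosh t ^ N := by
  rw [Real.cosh_eq, div_pow, add_pow, Finset.sum_div]
  refine Finset.sum_congr rfl fun k hk => ?_
  have hk' : k ≤ N := by simpa [Nat.lt_succ_iff] using hk
  rw [fairWeight, ← Real.exp_nat_mul, ← Real.exp_nat_mul, ← Real.exp_add, Nat.cast_sub hk']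
  rw [show (k * t + (N - k : ℝ) * -t : ℝ) = t * (2 * k - N) by ring]
  ring

/-- Hubbard–Stratonovich linearisation: `exp (θ x ^ 2 / 2)` is the mean of `exp (√θ x g)` over a
standard Gaussian `g`. Summing over `k` first gives a power of `cosh`, which `cosh s ≤ exp (s ^ 2 /
2)` bounds by `exp (θ g ^ 2 / 2)`, independently of `N` and integrable because `θ < 1`. -/
theorem exists_sum_fairWeight_mul_exp_sq_le {θ : ℝ} (h0 : 0 ≤ θ) (hθ : θ < 1) :
    ∃ B : ℝ, 0 ≤ B ∧ ∀ N : ℕ,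
      ∑ k ∈ Finset.range (N + 1), fairWeight N k * Real.exp (θ * latticePoint N k ^ 2 / 2) ≤ B := by
  have hint : Integrable (fun g : ℝ => Real.exp (θ * g ^ 2 / 2)) (gaussianReal 0 1) := by
    rw [gaussianReal_of_var_ne_zero _ one_ne_zero,
      integrable_withDensity_iff (by fun_prop) (by simp [gaussianPDF])]
    have := (integrable_exp_neg_mul_sq (b := (1 - θ) / 2) (by linarith)).const_mul (1 / √(2 * Real.pi))
    refine this.congr (ae_of_all _ fun g => ?_)
    simp only [toReal_gaussianPDF, gaussianPDFReal, NNReal.coe_one, mul_one, sub_zero]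
    rw [mul_left_comm, ← Real.exp_add]
    congr 2
    · simp
    · ring
  have hmgf (s : ℝ) : ∫ g, Real.exp (s * g) ∂(gaussianReal 0 1) = Real.exp (s ^ 2 / 2) := by
    have := congrFun (mgf_id_gaussianReal (μ := 0) (v := 1)) s
    simpa [mgf] using this
  have hmint (s : ℝ) : Integrable (fun g => Real.exp (s * g)) (gaussianReal 0 1) :=
    integrable_exp_mul_gaussianReal s
  refine ⟨∫ g, Real.exp (θ * g ^ 2 / 2) ∂(gaussianReal 0 1), integral_nonneg fun _ => by positivity, fun N => ?_⟩
  have h1 (k : ℕ) : fairWeight N k * Real.exp (θ * latticePoint N k ^ 2 / 2) =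
      ∫ g, fairWeight N k * Real.exp (√θ * latticePoint N k * g) ∂(gaussianReal 0 1) := by
    rw [integral_const_mul, hmgf, mul_pow, Real.sq_sqrt h0]
  simp_rw [h1]
  rw [← integral_finsetSum _ fun k _ => (hmint _).const_mul _]
  refine integral_mono (integrable_finsetSum _ fun k _ => (hmint _).const_mul _) hint fun g => ?_
  have h2 (k : ℕ) : √θ * latticePoint N k * g = (√θ * g / √N) * (2 * k - N) := by
    rw [latticePoint]; ring
  simp only [h2]
  rw [sum_fairWeight_mul_exp]
  calc _ ≤ Real.exp ((√θ * g / √N) ^ 2 / 2) ^ N := by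
        gcongr
        exact Real.cosh_le_exp_half_sq _
    _ ≤ _ := by
        rw [← Real.exp_nat_mul]
        gcongr
        rw [div_pow, mul_pow, Real.sq_sqrt h0, Real.sq_sqrt (by positivity)]
        rcases N.eq_zero_or_pos with rfl | hN
        · simp; positivity
        · field_simp
          exact le_rfl

/-! ### Reduction from spin configurations to counts -/

variable {d : ℕ}

/-- The quadratic form of the matrix `J` conjugated by the diagonal matrix with entries `r`. -/
noncomputable def scaledForm (J : Matrix (Fin d) (Fin d) ℝ) (r x : Fin d → ℝ) : ℝ :=
  ∑ δ, ∑ γ, J δ γ * ((r δ * x δ) * (r γ * x γ))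

/-- The vector of rescaled group magnetizations if the group `δ` contains `k δ` spins `1`. -/
noncomputable def magnetizationPoint (N k : Fin d → ℕ) : Fin d → ℝ :=
  fun δ => latticePoint (N δ) (k δ)

/-- The square roots of the fractions of spins in each of the groups. -/
noncomputable def sqrtFraction (N : Fin d → ℕ) : Fin d → ℝ :=
  fun δ => √((N δ : ℝ) / (∑ γ, N γ : ℕ))

/-- The unnormalised weight of all configurations with `k δ` spins `1` in the group `δ`. -/
noncomputable def latticeWeight (J : Matrix (Fin d) (Fin d) ℝ) (N k : Fin d → ℕ) : ℝ :=
  (∏ δ, fairWeight (N δ) (k δ)) *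
    Real.exp (scaledForm J (sqrtFraction N) (magnetizationPoint N k) / 2)

/-- The possible numbers of spins `1` in each of the groups. -/
def countBox (N : Fin d → ℕ) : Finset (Fin d → ℕ) :=
  Fintype.piFinset fun δ => Finset.range (N δ + 1)

/-- The unnormalised weight of the event that the rescaled magnetizations lie in `S`. -/
noncomputable def latticeMass (J : Matrix (Fin d) (Fin d) ℝ) (N : Fin d → ℕ)
    (S : Set (Fin d → ℝ)) : ℝ :=
  ∑ k ∈ countBox N, S.indicator (fun _ => latticeWeight J N k) (magnetizationPoint N k)

theorem latticeWeight_nonneg (J : Matrix (Fin d) (Fin d) ℝ) (N k : Fin d → ℕ) :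
    0 ≤ latticeWeight J N k :=
  mul_nonneg (Finset.prod_nonneg fun _ _ => fairWeight_nonneg _ _) (Real.exp_pos _).le

/-- A spin configuration is determined by the sets of indices of the spins `1` in each group. -/
def plusSets (N : Fin d → ℕ) : SpinConfig N ≃ ∀ δ, Finset (Fin (N δ)) where
  toFun x δ := {i | x ⟨δ, i⟩ = 1}
  invFun s p := if p.2 ∈ s p.1 then 1 else -1
  left_inv x := by
    ext ⟨δ, i⟩
    rcases Int.units_eq_one_or (x ⟨δ, i⟩) with h | h <;> simp [h]
  right_inv s := by
    ext δ i
    by_cases h : i ∈ s δ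
    · simp [h]
    · simp [h]

/-- The number of spins `1` in each of the groups. -/
def plusCount {N : Fin d → ℕ} (x : SpinConfig N) : Fin d → ℕ :=
  fun δ => (plusSets N x δ).card

theorem sum_spin {N : Fin d → ℕ} (x : SpinConfig N) (δ : Fin d) :
    ∑ i, spin x δ i = 2 * plusCount x δ - N δ := by
  have h (i : Fin (N δ)) : spin x δ i = 2 * (if x ⟨δ, i⟩ = 1 then (1 : ℝ) else 0) - 1 := by
    unfold spin
    rcases Int.units_eq_one_or (x ⟨δ, i⟩) with h | h
    · simp [h]; norm_num
    · rw [h, if_neg (by decide)]; simp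
  simp_rw [h]
  rw [Finset.sum_sub_distrib, ← Finset.mul_sum]
  simp [plusCount, plusSets]

theorem sum_spin_eq_sqrt_mul {N : Fin d → ℕ} (x : SpinConfig N) (δ : Fin d) :
    ∑ i, spin x δ i = √(N δ : ℝ) * magnetizationPoint N (plusCount x) δ := by
  rcases (N δ).eq_zero_or_pos with h | h
  · have : IsEmpty (Fin (N δ)) := by rw [h]; infer_instance
    simp [h]
  · have : 0 < √(N δ : ℝ) := Real.sqrt_pos.2 (by exact_mod_cast h)
    rw [sum_spin, magnetizationPoint, latticePoint]
    field_simp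

theorem rescaledMagnetization_apply {N : Fin d → ℕ} (x : SpinConfig N) (δ : Fin d) :
    rescaledMagnetization x δ = magnetizationPoint N (plusCount x) δ := by
  simp only [rescaledMagnetization]
  rw [sum_spin, magnetizationPoint, latticePoint, one_div, inv_mul_eq_div]

theorem weight_eq (J : Matrix (Fin d) (Fin d) ℝ) (N : Fin d → ℕ) (x : SpinConfig N) :
    weight J N x =
      Real.exp (scaledForm J (sqrtFraction N) (magnetizationPoint N (plusCount x)) / 2) := by
  unfold weight scaledForm sqrtFraction
  congr 1
  rw [Finset.mul_sum, Finset.sum_div]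
  refine Finset.sum_congr rfl fun δ _ => ?_
  rw [Finset.mul_sum, Finset.sum_div]
  refine Finset.sum_congr rfl fun γ _ => ?_
  rw [← Fintype.sum_mul_sum, sum_spin_eq_sqrt_mul, sum_spin_eq_sqrt_mul,
    Real.sqrt_div (by positivity), Real.sqrt_div (by positivity)]
  have : (1 / (2 * ((∑ δ, N δ : ℕ) : ℝ))) =
      1 / (2 * (√((∑ δ, N δ : ℕ) : ℝ) * √((∑ δ, N δ : ℕ) : ℝ))) := by
    rw [Real.mul_self_sqrt (by positivity)]
  rw [this]
  ring

/-- The fibre of `plusCount` over `k` is a product of families of `k δ`-element sets, counted by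
binomial coefficients; the power of two turns these into probabilities. -/
theorem sum_plusCount (N : Fin d → ℕ) (F : (Fin d → ℕ) → ℝ) :
    ∑ x : SpinConfig N, F (plusCount x) =
      2 ^ (∑ δ, N δ) * ∑ k ∈ countBox N, (∏ δ, fairWeight (N δ) (k δ)) * F k := by
  have h1 : ∑ x : SpinConfig N, F (plusCount x) =
      ∑ s : ∀ δ, Finset (Fin (N δ)), F (fun δ => (s δ).card) :=
    Fintype.sum_equiv (plusSets N) _ _ fun x => rfl
  have h2 : ∀ s ∈ (Finset.univ : Finset (∀ δ, Finset (Fin (N δ)))),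
      (fun δ => (s δ).card) ∈ countBox N := fun s _ => by
    simp only [countBox, Fintype.mem_piFinset, Finset.mem_range, Nat.lt_succ_iff]
    exact fun δ => (Finset.card_le_univ _).trans (by simp)
  rw [h1, ← Finset.sum_fiberwise_of_maps_to h2, Finset.mul_sum]
  refine Finset.sum_congr rfl fun k _ => ?_
  have h3 : (Finset.univ.filter fun s : ∀ δ, Finset (Fin (N δ)) => (fun δ => (s δ).card) = k) =
      Fintype.piFinset fun δ => Finset.powersetCard (k δ) Finset.univ := by
    ext s
    simp [Fintype.mem_piFinset, funext_iff]
  rw [Finset.sum_congr rfl (g := fun _ => F k) (fun s hs => by rw [(Finset.mem_filter.1 hs).2]),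
    Finset.sum_const, h3, Fintype.card_piFinset, nsmul_eq_mul, ← mul_assoc]
  congr 1
  simp only [Finset.card_powersetCard, Finset.card_univ, Fintype.card_fin, fairWeight]
  rw [Finset.prod_div_distrib, Finset.prod_pow_eq_pow_sum]
  push_cast
  field_simp

theorem weight_pos (J : Matrix (Fin d) (Fin d) ℝ) (N : Fin d → ℕ) (x : SpinConfig N) :
    0 < weight J N x := Real.exp_pos _

instance measurableSingletonClass_intUnits : MeasurableSingletonClass ℤˣ where
  measurableSet_singleton u :=
    ⟨{(u : ℤ)}, measurableSet_singleton _, by ext v; simp [Units.ext_iff]⟩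

/-- The factor `2 ^ n` is common to the event and the partition function and cancels. -/
theorem curieWeissMeasure_real (J : Matrix (Fin d) (Fin d) ℝ) (N : Fin d → ℕ)
    (K : Fin d → Set ℝ) :
    (curieWeissMeasure J N).real
        {x | rescaledMagnetization x ∈ {y : EuclideanSpace ℝ (Fin d) | ∀ δ, y δ ∈ K δ}} =
      latticeMass J N (Set.univ.pi K) / latticeMass J N Set.univ := by
  classical
  have hZ0 : 0 < partitionFunction J N := by
    unfold partitionFunction
    exact Finset.sum_pos (fun x _ => weight_pos J N x) Finset.univ_nonempty
  have hZ : partitionFunction J N = 2 ^ (∑ δ, N δ) * latticeMass J N Set.univ := by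
    unfold partitionFunction latticeMass latticeWeight
    simp_rw [weight_eq]
    rw [sum_plusCount N fun k =>
      Real.exp (scaledForm J (sqrtFraction N) (magnetizationPoint N k) / 2)]
    simp
  have hM : ∑ x : SpinConfig N, {x : SpinConfig N | rescaledMagnetization x ∈
      {y : EuclideanSpace ℝ (Fin d) | ∀ δ, y δ ∈ K δ}}.indicator (weight J N) x =
      2 ^ (∑ δ, N δ) * latticeMass J N (Set.univ.pi K) := by
    have := sum_plusCount N fun k => (Set.univ.pi K).indicator (fun _ =>
      Real.exp (scaledForm J (sqrtFraction N) (magnetizationPoint N k) / 2)) (magnetizationPoint N k)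
    unfold latticeMass latticeWeight
    simp only [Set.indicator, Set.mem_pi, Set.mem_univ, forall_true_left, mul_ite, mul_zero,
      Set.mem_ofPred_eq, rescaledMagnetization_apply, weight_eq] at this ⊢
    exact this
  rw [← mul_div_mul_left _ _ (pow_ne_zero (∑ δ, N δ) (two_ne_zero (α := ℝ))), ← hZ, ← hM,
    curieWeissMeasure, measureReal_def, Measure.finsetSum_apply,
    ENNReal.toReal_sum (fun x _ => ?_), Finset.sum_div]
  · refine Finset.sum_congr rfl fun x _ => ?_
    rw [Measure.smul_apply, Measure.dirac_apply' _ (Set.toFinite _).measurableSet, smul_eq_mul,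
      ENNReal.toReal_mul, ENNReal.toReal_ofReal (by have := weight_pos J N x; positivity)]
    simp only [Set.indicator]
    split_ifs <;> simp
  · rw [Measure.smul_apply, smul_eq_mul]
    exact ENNReal.mul_ne_top ENNReal.ofReal_ne_top (measure_ne_top _ _)

/-! ### Gaussian measures as densities -/

section StdGaussian

variable {E : Type*} [NormedAddCommGroup E] [InnerProductSpace ℝ E] [FiniteDimensional ℝ E]
  [MeasurableSpace E] [BorelSpace E]

theorem integrable_exp_neg_norm_sq :
    Integrable (fun x : E => Real.exp (-‖x‖ ^ 2 / 2)) := by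
  have h := (GaussianFourier.integrable_cexp_neg_mul_sq_norm_add (b := (1 / 2 : ℂ)) (by norm_num)
    0 (0 : E)).norm
  refine h.congr (ae_of_all _ fun x => ?_)
  simp only [Complex.norm_exp]
  congr 1
  rw [zero_mul, add_zero, show (-(1 / 2) * (‖x‖ : ℂ) ^ 2) = ((-(1 / 2) * ‖x‖ ^ 2 : ℝ) : ℂ) by
    push_cast; ring, Complex.ofReal_re]
  ring

/-- The standard Gaussian measure has a density proportional to `exp (-‖x‖ ^ 2 / 2)`. -/
theorem exists_stdGaussian_real_eq : ∃ c : ℝ, 0 < c ∧ ∀ s : Set E, MeasurableSet s →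
    (stdGaussian E).real s = c * ∫ x in s, Real.exp (-‖x‖ ^ 2 / 2) := by
  set ν : Measure E := volume.withDensity fun x => ENNReal.ofReal (Real.exp (-‖x‖ ^ 2 / 2)) with hν
  have hreal (s : Set E) (hs : MeasurableSet s) :
      ν.real s = ∫ x in s, Real.exp (-‖x‖ ^ 2 / 2) := by
    rw [measureReal_def, hν, withDensity_apply _ hs, integral_eq_lintegral_of_nonneg_ae
      (ae_of_all _ fun _ => (Real.exp_pos _).le) (Continuous.aestronglyMeasurable (by fun_prop))]
  have : IsFiniteMeasure ν := isFiniteMeasure_withDensity_ofReal integrable_exp_neg_norm_sq.2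
  have hchar (t : E) : charFun ν t =
      (Real.pi / (1 / 2 : ℂ)) ^ (Module.finrank ℝ E / 2 : ℂ) * Complex.exp (-‖t‖ ^ 2 / 2) := by
    have h := GaussianFourier.integral_cexp_neg_mul_sq_norm_add (b := (1 / 2 : ℂ)) (by norm_num)
      Complex.I t
    rw [charFun_apply, hν, integral_withDensity_eq_integral_toReal_smul (by fun_prop) (by simp)]
    refine Eq.trans (integral_congr_ae (ae_of_all _ fun x => ?_)) (h.trans ?_)
    · simp only [ENNReal.toReal_ofReal (Real.exp_pos _).le, Complex.real_smul, Complex.ofReal_exp,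
        ← Complex.exp_add]
      congr 1
      rw [real_inner_comm]
      push_cast
      ring
    · rw [Complex.I_sq]
      congr 2
      ring
  -- Evaluating at `0` identifies the prefactor of the characteristic function with the total mass,
  -- so its explicit value is never needed.
  have hm : ((ν.real Set.univ : ℝ) : ℂ) =
      (Real.pi / (1 / 2 : ℂ)) ^ (Module.finrank ℝ E / 2 : ℂ) := by
    have := hchar 0
    simpa using this
  have hpos : 0 < ν.real Set.univ := by
    rw [hreal _ MeasurableSet.univ, setIntegral_univ]
    exact integral_exp_pos integrable_exp_neg_norm_sq
  have heq : ν = (ν.real Set.univ).toNNReal • stdGaussian E := by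
    refine Measure.ext_of_charFun (funext fun t => ?_)
    rw [hchar, ← hm, charFun_apply, integral_smul_nnreal_measure, ← charFun_apply,
      charFun_stdGaussian, NNReal.smul_def, Real.coe_toNNReal _ hpos.le, Complex.real_smul]
  refine ⟨(ν.real Set.univ)⁻¹, by positivity, fun s hs => ?_⟩
  rw [← hreal s hs]
  have : ν.real s = ν.real Set.univ * (stdGaussian E).real s := by
    conv_lhs => rw [heq]
    rw [measureReal_nnreal_smul_apply, Real.coe_toNNReal _ hpos.le]
  rw [this]
  field_simp

end StdGaussian

open scoped MatrixOrder in
/-- The multivariate Gaussian measure with an invertible covariance matrix `C` has a density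
proportional to `exp (-(y ⬝ᵥ C⁻¹ *ᵥ y) / 2)`. -/
theorem exists_multivariateGaussian_real_eq {C Q : Matrix (Fin d) (Fin d) ℝ} (hC : C.PosDef)
    (hQ : C * Q = 1) : ∃ c : ℝ, 0 < c ∧ ∀ s : Set (EuclideanSpace ℝ (Fin d)), MeasurableSet s →
      (multivariateGaussian 0 C).real s =
        c * ∫ y in WithLp.toLp 2 ⁻¹' s, Real.exp (-(y ⬝ᵥ Q *ᵥ y) / 2) := by
  obtain ⟨m, hm, hstd⟩ := exists_stdGaussian_real_eq (E := EuclideanSpace ℝ (Fin d))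
  set B := CFC.sqrt C with hB
  have hBB : B * B = C := CFC.sqrt_mul_sqrt_self _ hC.posSemidef.nonneg
  have hBsa : IsSelfAdjoint B := (CFC.sqrt_nonneg C).isSelfAdjoint
  -- In `B * (B * Q) = 1` the right inverse of a square matrix is also a left inverse. Hence the
  -- form of `Q` at `B x` is `‖x‖ ^ 2`, and the substitution `y = B x` carries the standard density
  -- to the desired one.
  have hBQB : B * Q * B = 1 := by
    rw [← hBB, mul_assoc] at hQ
    exact mul_eq_one_comm.1 hQ
  set L := Matrix.toEuclideanCLM (𝕜 := ℝ) B with hL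
  set g : EuclideanSpace ℝ (Fin d) → ℝ :=
    fun y => Real.exp (-(y.ofLp ⬝ᵥ Q *ᵥ y.ofLp) / 2) with hg
  have hgL (x : EuclideanSpace ℝ (Fin d)) : g (L x) = Real.exp (-‖x‖ ^ 2 / 2) := by
    have h1 : (L x).ofLp = B *ᵥ x.ofLp := by
      simp [hL]
    have hBt : Bᵀ = B := by simpa [Matrix.star_eq_conjTranspose] using hBsa.star_eq
    have h2 : (B *ᵥ x.ofLp) ⬝ᵥ Q *ᵥ (B *ᵥ x.ofLp) = ‖x‖ ^ 2 := by
      rw [Matrix.mulVec_mulVec, Matrix.dotProduct_mulVec, ← Matrix.vecMul_transpose,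
        Matrix.vecMul_vecMul, hBt, ← mul_assoc, hBQB, Matrix.vecMul_one,
        EuclideanSpace.real_norm_sq_eq]
      simp [dotProduct, sq]
    rw [hg]
    simp only
    rw [h1, h2]
  have hdet : LinearMap.det (L : EuclideanSpace ℝ (Fin d) →ₗ[ℝ] EuclideanSpace ℝ (Fin d)) ≠ 0 := by
    have hunit : IsUnit L :=
      (IsUnit.of_mul_eq_one (Q * B) (by rw [← mul_assoc, hBQB])).map
        (Matrix.toEuclideanCLM (𝕜 := ℝ))
    have hunit' := hunit.map
      (ContinuousLinearMap.toLinearMapRingHom : (EuclideanSpace ℝ (Fin d) →L[ℝ] _) →+* _)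
    exact (LinearMap.isUnit_det _ hunit').ne_zero
  refine ⟨m * |(LinearMap.det (L : EuclideanSpace ℝ (Fin d) →ₗ[ℝ] EuclideanSpace ℝ (Fin d)))⁻¹|,
    by positivity, fun s hs => ?_⟩
  have hLm : Measurable L := L.continuous.measurable
  have hmap := Measure.map_linearMap_addHaar_eq_smul_addHaar
    (volume : Measure (EuclideanSpace ℝ (Fin d))) hdet
  have h3 : ∫ x in L ⁻¹' s, Real.exp (-‖x‖ ^ 2 / 2) =
      |(LinearMap.det (L : EuclideanSpace ℝ (Fin d) →ₗ[ℝ] EuclideanSpace ℝ (Fin d)))⁻¹| *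
        ∫ y in s, g y := by
    simp_rw [← hgL]
    have hgm : Continuous g := by
      rw [hg]; simp only [dotProduct, Matrix.mulVec]; fun_prop
    have h4 := setIntegral_map (μ := (volume : Measure (EuclideanSpace ℝ (Fin d)))) hs
      hgm.aestronglyMeasurable hLm.aemeasurable
    rw [← h4]
    have h5 : Measure.map L volume = _ := hmap
    rw [h5, Measure.restrict_smul, integral_smul_measure, ENNReal.toReal_ofReal (abs_nonneg _),
      smul_eq_mul]
  have h6 : ∫ y in s, g y = ∫ y in WithLp.toLp 2 ⁻¹' s, Real.exp (-(y ⬝ᵥ Q *ᵥ y) / 2) := by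
    rw [← (PiLp.volume_preserving_toLp (Fin d)).setIntegral_preimage_emb
      (MeasurableEquiv.toLp 2 (Fin d → ℝ)).measurableEmbedding]
  rw [multivariateGaussian]
  simp only [zero_add]
  rw [map_measureReal_apply hLm hs, hstd _ (hLm hs), h3, h6, mul_assoc]

/-! ### The limiting covariance matrix and its inverse -/

/-- Between constant matrices a diagonal matrix acts only through its trace. As the fractions sum to
one, the homogeneous case becomes the scalar identity `t - β - t β = 0` for `t = β / (1 - β)`. -/
theorem constMatrix_mul_fractionMatrix_mul_constMatrix (α : Fin d → ℝ) (s t : ℝ) :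
    constMatrix d s * fractionMatrix α * constMatrix d t =
      constMatrix d (s * (∑ δ, α δ) * t) := by
  ext i j
  simp [constMatrix, fractionMatrix, Matrix.mul_apply, Matrix.diagonal_apply, Finset.mul_sum,
    Finset.sum_mul]

theorem sqrtFractionMatrix_mul_self {α : Fin d → ℝ} (hα : ∀ δ, 0 ≤ α δ) :
    sqrtFractionMatrix α * sqrtFractionMatrix α = fractionMatrix α := by
  rw [sqrtFractionMatrix, fractionMatrix, Matrix.diagonal_mul_diagonal]
  simp_rw [fun δ => Real.mul_self_sqrt (hα δ)]

theorem posSemidef_constMatrix {t : ℝ} (ht : 0 ≤ t) : (constMatrix d t).PosSemidef := by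
  have h : constMatrix d t = Matrix.vecMulVec (fun _ => √t) (star fun _ => √t) := by
    ext i j
    simp [constMatrix, Matrix.vecMulVec_apply, Real.mul_self_sqrt ht]
  rw [h]
  exact Matrix.posSemidef_vecMulVec_self_star _

theorem posSemidef_sqrtFractionMatrix_mul_mul {M : Matrix (Fin d) (Fin d) ℝ} (α : Fin d → ℝ)
    (hM : M.PosSemidef) : (sqrtFractionMatrix α * M * sqrtFractionMatrix α).PosSemidef := by
  have := hM.mul_mul_conjTranspose_same (sqrtFractionMatrix α)
  rwa [show (sqrtFractionMatrix α)ᴴ = sqrtFractionMatrix α by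
    simp [sqrtFractionMatrix]] at this

/-- In the high-temperature regime the limiting covariance matrix is positive definite. -/
theorem HighTemperature.posDef {α : Fin d → ℝ} {J C : Matrix (Fin d) (Fin d) ℝ}
    (h : HighTemperature α J C) : C.PosDef := by
  cases h with
  | homogeneous β hβ hβ' =>
    exact Matrix.PosDef.one.add_posSemidef (posSemidef_sqrtFractionMatrix_mul_mul α
      (posSemidef_constMatrix (div_nonneg hβ (by linarith))))
  | heterogeneous J hJ hJα =>
    exact Matrix.PosDef.one.add_posSemidef (posSemidef_sqrtFractionMatrix_mul_mul α
      hJα.inv.posSemidef)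

/-- In the high-temperature regime `1 - √A * J * √A` is the inverse of the limiting covariance
matrix. -/
theorem HighTemperature.mul_eq_one {α : Fin d → ℝ} {J C : Matrix (Fin d) (Fin d) ℝ}
    (hα : ∀ δ, 0 ≤ α δ) (hα1 : ∑ δ, α δ = 1) (h : HighTemperature α J C) :
    C * (1 - sqrtFractionMatrix α * J * sqrtFractionMatrix α) = 1 := by
  -- Both regimes reduce to the same resolvent identity for the middle factor `D` of `C - 1`.
  have key (D J : Matrix (Fin d) (Fin d) ℝ) (hD : D - J - D * fractionMatrix α * J = 0) :
      (1 + sqrtFractionMatrix α * D * sqrtFractionMatrix α) *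
        (1 - sqrtFractionMatrix α * J * sqrtFractionMatrix α) = 1 := by
    have : (1 + sqrtFractionMatrix α * D * sqrtFractionMatrix α) *
        (1 - sqrtFractionMatrix α * J * sqrtFractionMatrix α) =
        1 + sqrtFractionMatrix α * (D - J - D * fractionMatrix α * J) * sqrtFractionMatrix α := by
      rw [← sqrtFractionMatrix_mul_self hα]
      noncomm_ring
    rw [this, hD]
    simp
  cases h with
  | homogeneous β hβ hβ' =>
    refine key _ _ ?_
    rw [constMatrix_mul_fractionMatrix_mul_constMatrix, hα1]
    ext i j
    have : 1 - β ≠ 0 := by linarith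
    simp [constMatrix]
    field_simp
    ring
  | heterogeneous J hJ hJα =>
    refine key _ _ ?_
    set D := (J⁻¹ - fractionMatrix α)⁻¹ with hD
    have h1 : D * (J⁻¹ - fractionMatrix α) = 1 :=
      Matrix.nonsing_inv_mul _ ((Matrix.isUnit_iff_isUnit_det _).1 hJα.isUnit)
    have h2 : J⁻¹ * J = 1 := Matrix.nonsing_inv_mul _ ((Matrix.isUnit_iff_isUnit_det _).1 hJ.isUnit)
    have : D - J - D * fractionMatrix α * J = (D * (J⁻¹ - fractionMatrix α) - 1) * J - D * (J⁻¹ * J - 1) := by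
      noncomm_ring
    rw [this, h1, h2]
    simp

/-- Matches the quadratic form in the Gaussian exponent with the exponent that the lattice weights
produce. -/
theorem scaledForm_sqrt_eq (J : Matrix (Fin d) (Fin d) ℝ) (α x : Fin d → ℝ) :
    x ⬝ᵥ (1 - sqrtFractionMatrix α * J * sqrtFractionMatrix α) *ᵥ x =
      ∑ δ, x δ ^ 2 - scaledForm J (fun δ => √(α δ)) x := by
  rw [Matrix.sub_mulVec, Matrix.one_mulVec, dotProduct_sub]
  congr 1
  · simp [dotProduct, sq]
  · rw [scaledForm, sqrtFractionMatrix]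
    simp only [dotProduct, Matrix.mulVec, Matrix.mul_diagonal, Matrix.diagonal_mul, Finset.mul_sum]
    refine Finset.sum_congr rfl fun δ _ => Finset.sum_congr rfl fun γ _ => ?_
    ring

/-- A positive definite quadratic form is bounded below by a multiple of the norm squared. -/
theorem exists_mul_sum_sq_le {Q : Matrix (Fin d) (Fin d) ℝ} (hQ : Q.PosDef) :
    ∃ c : ℝ, 0 < c ∧ ∀ x : Fin d → ℝ, c * ∑ δ, x δ ^ 2 ≤ x ⬝ᵥ Q *ᵥ x := by
  rcases isEmpty_or_nonempty (Fin d) with hd | hd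
  · exact ⟨1, one_pos, fun x => by simp⟩
  have hcont : Continuous fun x : EuclideanSpace ℝ (Fin d) => x.ofLp ⬝ᵥ Q *ᵥ x.ofLp := by
    simp only [dotProduct, Matrix.mulVec]; fun_prop
  obtain ⟨x₀, hx₀, hmin⟩ := (isCompact_sphere (0 : EuclideanSpace ℝ (Fin d)) 1).exists_isMinOn
    (NormedSpace.sphere_nonempty.2 zero_le_one) hcont.continuousOn
  have hx0 : x₀.ofLp ≠ 0 := fun h => by
    have : x₀ = 0 := by simpa using h
    simp [this] at hx₀
  refine ⟨x₀.ofLp ⬝ᵥ Q *ᵥ x₀.ofLp, by simpa using hQ.dotProduct_mulVec_pos hx0, fun x => ?_⟩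
  set y : EuclideanSpace ℝ (Fin d) := WithLp.toLp 2 x with hy
  have hsq : ∑ δ, x δ ^ 2 = ‖y‖ ^ 2 := by rw [EuclideanSpace.real_norm_sq_eq]
  rw [hsq]
  by_cases h0 : y = 0
  · have : x = 0 := by simpa [hy] using h0
    simp [h0, this]
  have hn : 0 < ‖y‖ := norm_pos_iff.2 h0
  have := hmin (show ‖y‖⁻¹ • y ∈ Metric.sphere 0 1 by simp [norm_smul, hn.ne'])
  simp only [WithLp.ofLp_smul, Matrix.mulVec_smul, dotProduct_smul, smul_dotProduct, smul_eq_mul,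
    Set.mem_ofPred_eq] at this
  calc _ ≤ (‖y‖⁻¹ * (‖y‖⁻¹ * (x ⬝ᵥ Q *ᵥ x))) * ‖y‖ ^ 2 := by gcongr
    _ = _ := by field_simp

/-! ### The limiting density and the multi-group local limit theorem -/

/-- The unnormalised density of the limiting distribution. -/
noncomputable def limitDensity (J : Matrix (Fin d) (Fin d) ℝ) (r y : Fin d → ℝ) : ℝ :=
  Real.exp ((scaledForm J r y - ∑ δ, y δ ^ 2) / 2)

theorem continuous_scaledForm (J : Matrix (Fin d) (Fin d) ℝ) :
    Continuous fun p : (Fin d → ℝ) × (Fin d → ℝ) => scaledForm J p.1 p.2 := by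
  unfold scaledForm; fun_prop

theorem continuous_limitDensity (J : Matrix (Fin d) (Fin d) ℝ) :
    Continuous fun p : (Fin d → ℝ) × (Fin d → ℝ) => limitDensity J p.1 p.2 := by
  unfold limitDensity
  have := continuous_scaledForm J
  fun_prop

theorem continuous_limitDensity_comp (J : Matrix (Fin d) (Fin d) ℝ) (r : Fin d → ℝ) {T : Type*}
    [TopologicalSpace T] {f : T → Fin d → ℝ} (hf : Continuous f) :
    Continuous fun t => limitDensity J r (f t) := by
  unfold limitDensity scaledForm; fun_prop

theorem limitDensity_pos (J : Matrix (Fin d) (Fin d) ℝ) (r y : Fin d → ℝ) :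
    0 < limitDensity J r y := Real.exp_pos _

theorem abs_scaledForm_le (J : Matrix (Fin d) (Fin d) ℝ) {r x : Fin d → ℝ} {R : ℝ}
    (hr : ∀ δ, |r δ| ≤ 1) (hx : ∀ δ, |x δ| ≤ R) :
    |scaledForm J r x| ≤ (∑ δ, ∑ γ, |J δ γ|) * R ^ 2 := by
  rw [Finset.sum_mul, scaledForm]
  refine (Finset.abs_sum_le_sum_abs _ _).trans (Finset.sum_le_sum fun δ _ => ?_)
  rw [Finset.sum_mul]
  refine (Finset.abs_sum_le_sum_abs _ _).trans (Finset.sum_le_sum fun γ _ => ?_)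
  have h (δ : Fin d) : |r δ * x δ| ≤ R := by
    rw [abs_mul]
    have := mul_le_mul (hr δ) (hx δ) (abs_nonneg _) zero_le_one
    simpa using this
  rw [abs_mul, abs_mul, sq]
  gcongr
  · exact (abs_nonneg _).trans (h δ)
  · exact h δ
  · exact h γ

theorem abs_sqrtFraction_le_one (N : Fin d → ℕ) (δ : Fin d) : |sqrtFraction N δ| ≤ 1 := by
  rw [sqrtFraction, abs_of_nonneg (Real.sqrt_nonneg _), Real.sqrt_le_one]
  refine div_le_one_of_le₀ ?_ (by positivity)
  exact_mod_cast Finset.single_le_sum (f := N) (fun _ _ => Nat.zero_le _) (Finset.mem_univ δ)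

/-- Inserting `exp (x ^ 2 / 2)` in each group and compensating in the density separates a factor
with a constant limit from a continuous function of the lattice point. -/
theorem prod_sqrt_mul_latticeWeight (J : Matrix (Fin d) (Fin d) ℝ) (N k : Fin d → ℕ) :
    (∏ δ, √(N δ : ℝ) / 2) * latticeWeight J N k =
      (∏ δ, √(N δ : ℝ) / 2 * fairWeight (N δ) (k δ) * Real.exp (latticePoint (N δ) (k δ) ^ 2 / 2)) *
        limitDensity J (sqrtFraction N) (magnetizationPoint N k) := by
  rw [Finset.prod_mul_distrib, Finset.prod_mul_distrib, latticeWeight, limitDensity,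
    ← Real.exp_sum, mul_assoc _ (Real.exp _) (Real.exp _), ← Real.exp_add, ← mul_assoc]
  congr 2
  rw [← Finset.sum_div]
  simp only [magnetizationPoint]
  ring

/-- The local limit theorem for the unnormalised lattice weights. -/
theorem tendsto_latticeWeight_sub {ι : Type*} {l : Filter ι} (J : Matrix (Fin d) (Fin d) ℝ)
    {N k : ι → Fin d → ℕ} {r : Fin d → ℝ} {y : ι → Fin d → ℝ} {R : ℝ}
    (hN : ∀ δ, Tendsto (fun i => N i δ) l atTop)
    (hr : ∀ δ, Tendsto (fun i => sqrtFraction (N i) δ) l (𝓝 (r δ)))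
    (hy : ∀ᶠ i in l, ∀ δ, |y i δ| ≤ R)
    (hk : ∀ᶠ i in l, ∀ δ, |magnetizationPoint (N i) (k i) δ - y i δ| ≤ 2 / √(N i δ : ℝ)) :
    Tendsto (fun i => (∏ δ, √(N i δ : ℝ) / 2) * latticeWeight J (N i) (k i) -
      (1 / √(2 * Real.pi)) ^ d * limitDensity J r (y i)) l (𝓝 0) := by
  -- The points `y i` need not converge, but they stay in a compact cube and so converge along every
  -- ultrafilter, where continuity of the density finishes the argument.
  rw [tendsto_iff_ultrafilter]
  intro g hg
  have hcomp : IsCompact (Set.univ.pi fun _ : Fin d => Set.Icc (-R) R) :=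
    isCompact_univ_pi fun _ => isCompact_Icc
  have hmem : ∀ᶠ i in (g : Filter ι), y i ∈ Set.univ.pi fun _ : Fin d => Set.Icc (-R) R := by
    filter_upwards [hy.filter_mono hg] with i hi δ _
    exact abs_le.1 (hi δ)
  obtain ⟨y₀, hy₀, hlim⟩ := hcomp.ultrafilter_le_nhds' (g.map y) hmem
  have hlim : Tendsto y (g : Filter ι) (𝓝 y₀) := hlim
  have hlim' := hlim
  rw [tendsto_pi_nhds] at hlim'
  have hx (δ : Fin d) : Tendsto (fun i => magnetizationPoint (N i) (k i) δ) g (𝓝 (y₀ δ)) := by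
    have h0 : Tendsto (fun i => magnetizationPoint (N i) (k i) δ - y i δ) g (𝓝 0) := by
      refine squeeze_zero_norm' (a := fun i => 2 / √(N i δ : ℝ)) ?_ ?_
      · filter_upwards [hk.filter_mono hg] with i hi using hi δ
      · exact ((Real.tendsto_sqrt_atTop.comp (tendsto_natCast_atTop_atTop.comp
          ((hN δ).mono_left hg))).const_div_atTop _)
    simpa using h0.add (hlim' δ)
  have hw (δ : Fin d) := tendsto_sqrt_mul_fairWeight (R := |y₀ δ| + 1) (k := fun i => k i δ)
    ((hN δ).mono_left hg) (by
      filter_upwards [(hx δ).abs.eventually_lt_const (lt_add_one _)] with i hi using hi.le)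
  have h1 := tendsto_finsetProd Finset.univ fun δ _ => hw δ
  have hc := (continuous_limitDensity J).tendsto (r, y₀)
  have hx' : Tendsto (fun i => magnetizationPoint (N i) (k i)) g (𝓝 y₀) := tendsto_pi_nhds.2 hx
  have hr' : Tendsto (fun i => sqrtFraction (N i)) g (𝓝 r) :=
    tendsto_pi_nhds.2 fun δ => (hr δ).mono_left hg
  have h2 := hc.comp (hr'.prodMk_nhds hx')
  have h3 := hc.comp ((tendsto_const_nhds (x := r)).prodMk_nhds hlim)
  have h4 := (h1.mul h2).sub (h3.const_mul ((1 / √(2 * Real.pi)) ^ d))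
  rw [Finset.prod_const, Finset.card_univ, Fintype.card_fin, sub_self] at h4
  refine h4.congr fun i => ?_
  rw [prod_sqrt_mul_latticeWeight]
  rfl

/-! ### Lattice sums as integrals of step functions -/

/-- A sum over lattice points is an integral of a step function. -/
theorem integrable_and_integral_floor {a b : Fin d → ℝ} (ha : ∀ δ, 0 < a δ)
    {G : (Fin d → ℕ) → ℝ} {B : Finset (Fin d → ℕ)} (hG : ∀ k ∉ B, G k = 0) :
    Integrable (fun t : Fin d → ℝ =>
        if ∀ δ, 0 ≤ a δ * t δ + b δ then G (fun δ => ⌊a δ * t δ + b δ⌋₊) else 0) ∧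
      ∫ t : Fin d → ℝ, (if ∀ δ, 0 ≤ a δ * t δ + b δ then
        G (fun δ => ⌊a δ * t δ + b δ⌋₊) else 0) = (∏ δ, (a δ)⁻¹) * ∑ k ∈ B, G k := by
  classical
  set cell : (Fin d → ℕ) → Set (Fin d → ℝ) := fun k =>
    Set.univ.pi fun δ => Set.Ico ((k δ - b δ) / a δ) ((k δ + 1 - b δ) / a δ) with hcell
  have hmem (k : Fin d → ℕ) (t : Fin d → ℝ) : t ∈ cell k ↔
      (∀ δ, 0 ≤ a δ * t δ + b δ) ∧ (fun δ => ⌊a δ * t δ + b δ⌋₊) = k := by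
    simp only [hcell, Set.mem_pi, Set.mem_univ, forall_true_left, Set.mem_Ico, funext_iff,
      ← forall_and]
    refine forall_congr' fun δ => ?_
    rw [div_le_iff₀ (ha δ), lt_div_iff₀ (ha δ)]
    constructor
    · rintro ⟨h1, h2⟩
      have h0 : 0 ≤ a δ * t δ + b δ := by
        have : (0 : ℝ) ≤ k δ := Nat.cast_nonneg _
        linarith
      exact ⟨h0, (Nat.floor_eq_iff h0).2 ⟨by linarith, by linarith⟩⟩
    · rintro ⟨h0, h1⟩
      have := (Nat.floor_eq_iff h0).1 h1
      constructor <;> linarith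
  have hstep : (fun t : Fin d → ℝ =>
      if ∀ δ, 0 ≤ a δ * t δ + b δ then G (fun δ => ⌊a δ * t δ + b δ⌋₊) else 0) =
      fun t => ∑ k ∈ B, (cell k).indicator (fun _ => G k) t := by
    ext t
    simp only [Set.indicator, hmem]
    split_ifs with h
    · by_cases hB : (fun δ => ⌊a δ * t δ + b δ⌋₊) ∈ B
      · rw [Finset.sum_eq_single_of_mem _ hB]
        · simp [h]
        · intro k _ hk
          rw [if_neg fun h' => hk h'.2.symm]
      · rw [hG _ hB, Finset.sum_eq_zero]
        intro k hk
        rw [if_neg]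
        rintro ⟨_, rfl⟩
        exact hB hk
    · simp [h]
  have hmeas (k : Fin d → ℕ) : MeasurableSet (cell k) :=
    MeasurableSet.univ_pi fun _ => measurableSet_Ico
  have hvol (k : Fin d → ℕ) : volume (cell k) = ENNReal.ofReal (∏ δ, (a δ)⁻¹) := by
    rw [hcell, volume_pi_pi, ENNReal.ofReal_prod_of_nonneg fun δ _ => (inv_pos.2 (ha δ)).le]
    refine Finset.prod_congr rfl fun δ _ => ?_
    rw [Real.volume_Ico]
    congr 1
    rw [← sub_div, inv_eq_one_div]
    congr 1
    ring
  have hint (k : Fin d → ℕ) : Integrable ((cell k).indicator fun _ => G k) :=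
    (integrable_indicator_iff (hmeas k)).2 (integrableOn_const (by rw [hvol]; exact ENNReal.ofReal_ne_top))
  rw [hstep]
  refine ⟨integrable_finsetSum _ fun k _ => hint k, ?_⟩
  rw [integral_finsetSum _ fun k _ => hint k, Finset.mul_sum]
  refine Finset.sum_congr rfl fun k _ => ?_
  rw [integral_indicator (hmeas k), setIntegral_const, measureReal_def, hvol,
    ENNReal.toReal_ofReal (Finset.prod_nonneg fun δ _ => (inv_pos.2 (ha δ)).le), smul_eq_mul]

theorem integral_eq_prod_mul_integral {lo L : Fin d → ℝ} (hL : ∀ δ, 0 < L δ)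
    (h : (Fin d → ℝ) → ℝ) (hh : Measurable h) :
    ∫ y, h y = (∏ δ, L δ) * ∫ t : Fin d → ℝ, h (fun δ => lo δ + L δ * t δ) := by
  have hdet : (Matrix.diagonal L).det ≠ 0 := by
    rw [Matrix.det_diagonal]; exact (Finset.prod_pos fun δ _ => hL δ).ne'
  have key := Real.smul_map_diagonal_volume_pi hdet
  have hP : 0 < ∏ δ, L δ := Finset.prod_pos fun δ _ => hL δ
  rw [Matrix.det_diagonal, abs_of_pos hP] at key
  calc ∫ y, h y = ∫ y, h (lo + y) := (integral_add_left_eq_self h lo).symm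
    _ = ∫ y, h (lo + y) ∂(ENNReal.ofReal (∏ δ, L δ) •
          Measure.map (Matrix.toLin' (Matrix.diagonal L)) volume) := by rw [key]
    _ = (∏ δ, L δ) * ∫ t, h (lo + Matrix.toLin' (Matrix.diagonal L) t) := by
        rw [integral_smul_measure, ENNReal.toReal_ofReal hP.le, smul_eq_mul,
          integral_map (LinearMap.continuous_of_finiteDimensional _).aemeasurable
            (Measurable.aestronglyMeasurable (by fun_prop))]
    _ = _ := by
        congr 1
        refine integral_congr_ae (ae_of_all _ fun t => ?_)
        simp only [Matrix.toLin'_apply]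
        congr 1
        ext δ
        simp [Matrix.mulVec_diagonal]

theorem latticePoint_floor {N : ℕ} (hN : 0 < N) {y : ℝ} (hz : 0 ≤ (y * √(N : ℝ) + N) / 2) :
    latticePoint N ⌊(y * √(N : ℝ) + N) / 2⌋₊ ≤ y ∧
      y < latticePoint N ⌊(y * √(N : ℝ) + N) / 2⌋₊ + 2 / √(N : ℝ) := by
  have hs : 0 < √(N : ℝ) := Real.sqrt_pos.2 (by exact_mod_cast hN)
  have h1 := Nat.floor_le hz
  have h2 := Nat.lt_floor_add_one ((y * √(N : ℝ) + N) / 2)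
  rw [latticePoint, ← add_div, div_le_iff₀ hs, lt_div_iff₀ hs]
  constructor <;> linarith

theorem latticeWeight_eq_zero (J : Matrix (Fin d) (Fin d) ℝ) {N k : Fin d → ℕ}
    (hk : k ∉ countBox N) : latticeWeight J N k = 0 := by
  simp only [countBox, Fintype.mem_piFinset, Finset.mem_range, not_forall, not_lt] at hk
  obtain ⟨δ, hδ⟩ := hk
  rw [latticeWeight, Finset.prod_eq_zero (Finset.mem_univ δ), zero_mul]
  simp [fairWeight, Nat.choose_eq_zero_of_lt (Nat.lt_of_succ_le hδ)]

/-- The numbers of spins `1` at the lattice point next to `y` from below. -/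
noncomputable def floorCount (N : Fin d → ℕ) (y : Fin d → ℝ) : Fin d → ℕ :=
  fun δ => ⌊(y δ * √(N δ : ℝ) + N δ) / 2⌋₊

open Classical in
/-- The step function on `ℝ ^ d` with cells of side lengths `2 / √(N δ)` whose integral is the
mass `latticeMass J N S`. -/
noncomputable def stepDensity (J : Matrix (Fin d) (Fin d) ℝ) (N : Fin d → ℕ)
    (S : Set (Fin d → ℝ)) (y : Fin d → ℝ) : ℝ :=
  if ∀ δ, 0 ≤ (y δ * √(N δ : ℝ) + N δ) / 2 then
    (∏ δ, √(N δ : ℝ) / 2) *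
      S.indicator (fun _ => latticeWeight J N (floorCount N y))
        (magnetizationPoint N (floorCount N y))
  else 0

/-- The variable `t` rescales a moving box to the unit cube, so that all integrals live on a common
domain. -/
theorem integrable_and_integral_stepDensity (J : Matrix (Fin d) (Fin d) ℝ) {N : Fin d → ℕ}
    (hN : ∀ δ, 0 < N δ) (S : Set (Fin d → ℝ)) {lo L : Fin d → ℝ} (hL : ∀ δ, 0 < L δ) :
    Integrable (fun t : Fin d → ℝ => stepDensity J N S (fun δ => lo δ + L δ * t δ)) ∧
      ∫ t : Fin d → ℝ, stepDensity J N S (fun δ => lo δ + L δ * t δ) = latticeMass J N S / ∏ δ, L δ := by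
  classical
  have hs (δ : Fin d) : 0 < √(N δ : ℝ) := Real.sqrt_pos.2 (by exact_mod_cast hN δ)
  have key := integrable_and_integral_floor (a := fun δ => L δ * √(N δ : ℝ) / 2)
    (b := fun δ => (lo δ * √(N δ : ℝ) + N δ) / 2)
    (G := fun k => (∏ δ, √(N δ : ℝ) / 2) *
      S.indicator (fun _ => latticeWeight J N k) (magnetizationPoint N k)) (B := countBox N)
    (fun δ => by have := hL δ; have := hs δ; positivity) (fun k hk => by
      rw [latticeWeight_eq_zero J hk]; simp)
  have hz (t : Fin d → ℝ) (δ : Fin d) : L δ * √(N δ : ℝ) / 2 * t δ + (lo δ * √(N δ : ℝ) + N δ) / 2 =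
      ((lo δ + L δ * t δ) * √(N δ : ℝ) + N δ) / 2 := by ring
  simp only [hz] at key
  refine ⟨?_, ?_⟩
  · convert key.1 using 2
    unfold stepDensity floorCount
    congr
  · calc _ = _ := by
          refine Eq.trans ?_ key.2
          congr 1
      _ = _ := by
          rw [← Finset.mul_sum, ← mul_assoc, ← Finset.prod_mul_distrib, latticeMass, div_eq_mul_inv,
            mul_comm, ← Finset.prod_inv_distrib]
          congr 1
          refine Finset.prod_congr rfl fun δ _ => ?_
          have := (hL δ).ne'
          have := (hs δ).ne'
          field_simp

/-- The bound depends on neither `N` nor `y`; it supplies the dominating constant. -/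
theorem abs_stepDensity_le (J : Matrix (Fin d) (Fin d) ℝ) {B R : ℝ}
    (hB : ∀ N k : ℕ, √(N : ℝ) / 2 * fairWeight N k ≤ B) {N : Fin d → ℕ} {S : Set (Fin d → ℝ)}
    (hS : ∀ x ∈ S, ∀ δ, |x δ| ≤ R) (y : Fin d → ℝ) :
    |stepDensity J N S y| ≤ B ^ d * Real.exp ((∑ δ, ∑ γ, |J δ γ|) * R ^ 2 / 2) := by
  classical
  have hB0 : 0 ≤ B := by
    have := hB 0 0
    simpa using this
  unfold stepDensity
  split_ifs
  · by_cases hmem : magnetizationPoint N (floorCount N y) ∈ S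
    · rw [Set.indicator_of_mem hmem, latticeWeight, ← mul_assoc, ← Finset.prod_mul_distrib, abs_mul,
        Real.abs_exp]
      have h1 := abs_scaledForm_le J (abs_sqrtFraction_le_one N) (hS _ hmem)
      gcongr
      · rw [abs_of_nonneg (Finset.prod_nonneg fun δ _ =>
          mul_nonneg (by positivity) (fairWeight_nonneg _ _))]
        refine (Finset.prod_le_prod (fun δ _ => mul_nonneg (by positivity) (fairWeight_nonneg _ _))
          fun δ _ => hB (N δ) _).trans ?_
        simp
      · exact (le_abs_self _).trans h1
    · rw [Set.indicator_of_notMem hmem]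
      simp
      positivity
  · simp
    positivity

theorem mem_of_stepDensity_ne_zero {J : Matrix (Fin d) (Fin d) ℝ} {N : Fin d → ℕ}
    {S : Set (Fin d → ℝ)} {y : Fin d → ℝ} (h : stepDensity J N S y ≠ 0) :
    (∀ δ, 0 ≤ (y δ * √(N δ : ℝ) + N δ) / 2) ∧ magnetizationPoint N (floorCount N y) ∈ S := by
  classical
  unfold stepDensity at h
  split_ifs at h with h0
  · refine ⟨h0, ?_⟩
    by_contra hmem
    rw [Set.indicator_of_notMem hmem] at h
    simp at h
  · exact absurd rfl h

/-- A lattice point in the box lies below `y` by less than one cell, so the step function is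
supported in the box extended by one cell upwards. -/
theorem bounds_of_stepDensity_ne_zero {J : Matrix (Fin d) (Fin d) ℝ} {N : Fin d → ℕ}
    (hN : ∀ δ, 0 < N δ) {K : Fin d → Set ℝ} {lo L : Fin d → ℝ} (hL : ∀ δ, 0 < L δ)
    (hK : ∀ δ, K δ ⊆ Set.Icc (lo δ) (lo δ + L δ)) {t : Fin d → ℝ}
    (h : stepDensity J N (Set.univ.pi K) (fun δ => lo δ + L δ * t δ) ≠ 0) (δ : Fin d) :
    0 ≤ t δ ∧ t δ ≤ 1 + 2 / (L δ * √(N δ : ℝ)) := by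
  obtain ⟨h0, hmem⟩ := mem_of_stepDensity_ne_zero h
  have h1 := latticePoint_floor (hN δ) (h0 δ)
  have h2 := hK δ (hmem δ (Set.mem_univ δ))
  simp only [magnetizationPoint, floorCount, Set.mem_Icc] at h2
  have hL := hL δ
  constructor
  · by_contra! hlt
    nlinarith
  · have : L δ * t δ ≤ L δ * (1 + 2 / (L δ * √(N δ : ℝ))) := by
      rw [mul_add, mul_one, ← mul_div_assoc, mul_div_mul_left _ _ hL.ne']
      linarith
    exact le_of_mul_le_mul_left this hL

/-- Whether the faces belong to the box is irrelevant, since they are null sets. -/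
theorem setIntegral_pi_eq {lo L : Fin d → ℝ} (hL : ∀ δ, 0 < L δ) {K : Fin d → Set ℝ}
    (h1 : ∀ δ, Set.Ioo (lo δ) (lo δ + L δ) ⊆ K δ) (h2 : ∀ δ, K δ ⊆ Set.Icc (lo δ) (lo δ + L δ))
    {f : (Fin d → ℝ) → ℝ} (hf : Measurable f) :
    ∫ y in Set.univ.pi K, f y =
      (∏ δ, L δ) * ∫ t in Set.Icc (0 : Fin d → ℝ) 1, f (fun δ => lo δ + L δ * t δ) := by
  have hae : (Set.univ.pi K : Set (Fin d → ℝ)) =ᵐ[volume] Set.Icc lo (lo + L) := by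
    refine EventuallyLE.antisymm ?_ ?_
    · refine LE.le.eventuallyLE ?_
      rw [← Set.pi_univ_Icc]
      exact Set.pi_mono fun δ _ => h2 δ
    · refine (Measure.univ_pi_Ioo_ae_eq_Icc (f := lo) (g := lo + L)).symm.le.trans ?_
      exact LE.le.eventuallyLE (Set.pi_mono fun δ _ => h1 δ)
  rw [setIntegral_congr_set hae, ← integral_indicator measurableSet_Icc,
    integral_eq_prod_mul_integral (lo := lo) hL _ (hf.indicator measurableSet_Icc),
    ← integral_indicator measurableSet_Icc]
  congr 1
  refine integral_congr_ae (ae_of_all _ fun t => ?_)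
  have : (fun δ => lo δ + L δ * t δ) ∈ Set.Icc lo (lo + L) ↔ t ∈ Set.Icc (0 : Fin d → ℝ) 1 := by
    simp only [Set.mem_Icc, Pi.le_def, Pi.add_apply, Pi.zero_apply, Pi.one_apply]
    refine and_congr (forall_congr' fun δ => ?_) (forall_congr' fun δ => ?_)
    · have := hL δ
      simp [mul_nonneg_iff_of_pos_left this]
    · have := hL δ
      simp [mul_le_iff_le_one_right this]
  beta_reduce
  by_cases ht : t ∈ Set.Icc (0 : Fin d → ℝ) 1
  · rw [Set.indicator_of_mem ht, Set.indicator_of_mem (this.2 ht)]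
  · rw [Set.indicator_of_notMem ht, Set.indicator_of_notMem fun h => ht (this.1 h)]

/-! ### Lattice masses of boxes longer than the lattice spacing -/

section BoxSequence

variable {ι : Type*} {l : Filter ι} {N : ι → Fin d → ℕ} {r : Fin d → ℝ} {lo L : ι → Fin d → ℝ}
  {K : ι → Fin d → Set ℝ} {R : ℝ}

/-- On the interior of the rescaled box, the step function is asymptotic to the limiting
density. -/
theorem tendsto_stepDensity_sub_of_interior (J : Matrix (Fin d) (Fin d) ℝ)
    (hN : ∀ δ, Tendsto (fun i => N i δ) l atTop)
    (hr : ∀ δ, Tendsto (fun i => sqrtFraction (N i) δ) l (𝓝 (r δ)))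
    (hbox : ∀ᶠ i in l, ∀ δ, 0 < L i δ ∧ -R ≤ lo i δ ∧ lo i δ + L i δ ≤ R)
    (hLN : ∀ δ, Tendsto (fun i => L i δ * √(N i δ : ℝ)) l atTop)
    (hK : ∀ᶠ i in l, ∀ δ, Set.Ioo (lo i δ) (lo i δ + L i δ) ⊆ K i δ)
    {t : Fin d → ℝ} (ht : ∀ δ, t δ ∈ Set.Ioo 0 1) :
    Tendsto (fun i => stepDensity J (N i) (Set.univ.pi (K i)) (fun δ => lo i δ + L i δ * t δ) -
      (1 / √(2 * Real.pi)) ^ d * limitDensity J r (fun δ => lo i δ + L i δ * t δ)) l (𝓝 0) := by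
  classical
  have hNs (δ : Fin d) : Tendsto (fun i => √(N i δ : ℝ)) l atTop :=
    Real.tendsto_sqrt_atTop.comp (tendsto_natCast_atTop_atTop.comp (hN δ))
  have hy : ∀ᶠ i in l, ∀ δ, |lo i δ + L i δ * t δ| ≤ R := by
    filter_upwards [hbox] with i hi δ
    obtain ⟨h1, h2, h3⟩ := hi δ
    have := ht δ
    rw [abs_le]
    constructor <;> nlinarith [this.1, this.2]
  have hN0 : ∀ᶠ i in l, ∀ δ, 0 < N i δ :=
    eventually_all.2 fun δ => (hN δ).eventually_gt_atTop 0
  have hz : ∀ᶠ i in l, ∀ δ, 0 ≤ ((lo i δ + L i δ * t δ) * √(N i δ : ℝ) + N i δ) / 2 := by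
    filter_upwards [hy, eventually_all.2 fun δ => (hNs δ).eventually_ge_atTop R] with i h1 h2 δ
    have h3 := (abs_le.1 (h1 δ)).1
    have h4 : (N i δ : ℝ) = √(N i δ : ℝ) * √(N i δ : ℝ) :=
      (Real.mul_self_sqrt (Nat.cast_nonneg _)).symm
    have h5 : 0 ≤ √(N i δ : ℝ) := Real.sqrt_nonneg _
    have h6 := h2 δ
    nlinarith
  have hfl : ∀ᶠ i in l, ∀ δ,
      |magnetizationPoint (N i) (floorCount (N i) fun δ => lo i δ + L i δ * t δ) δ -
        (lo i δ + L i δ * t δ)| ≤ 2 / √(N i δ : ℝ) := by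
    filter_upwards [hz, hN0] with i h1 h2 δ
    have := latticePoint_floor (h2 δ) (h1 δ)
    simp only [magnetizationPoint, floorCount]
    rw [abs_le]
    have : 0 ≤ 2 / √(N i δ : ℝ) := by positivity
    constructor <;> linarith
  refine (tendsto_latticeWeight_sub J hN hr hy hfl).congr' ?_
  -- Beyond the threshold `2 / t δ` the distance `L * t` to the lower end exceeds a cell, so
  -- rounding down stays inside the box.
  filter_upwards [hz, hN0, hK, hbox, eventually_all.2 fun δ =>
    (hLN δ).eventually_gt_atTop (2 / t δ)] with i h1 h2 h3 h4 h5
  rw [stepDensity, if_pos h1, Set.indicator_of_mem]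
  intro δ _
  refine h3 δ ?_
  have h6 := latticePoint_floor (h2 δ) (h1 δ)
  have hs : 0 < √(N i δ : ℝ) := Real.sqrt_pos.2 (by exact_mod_cast h2 δ)
  have h7 : 2 / √(N i δ : ℝ) < L i δ * t δ := by
    rw [div_lt_iff₀ hs]
    have := (div_lt_iff₀ (ht δ).1).1 (h5 δ)
    linarith
  have h8 : L i δ * t δ < L i δ := by nlinarith [(h4 δ).1, (ht δ).2]
  simp only [magnetizationPoint, floorCount, Set.mem_Ioo]
  constructor <;> linarith

theorem limitDensity_bounds (J : Matrix (Fin d) (Fin d) ℝ) (hr : ∀ δ, |r δ| ≤ 1) {y : Fin d → ℝ}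
    (hy : ∀ δ, |y δ| ≤ R) :
    Real.exp (-((∑ δ, ∑ γ, |J δ γ|) * R ^ 2 + d * R ^ 2) / 2) ≤ limitDensity J r y ∧
      limitDensity J r y ≤ Real.exp ((∑ δ, ∑ γ, |J δ γ|) * R ^ 2 / 2) := by
  have h1 := abs_le.1 (abs_scaledForm_le J hr hy)
  have h2 : 0 ≤ ∑ δ, y δ ^ 2 := Finset.sum_nonneg fun _ _ => sq_nonneg _
  have h3 : ∑ δ, y δ ^ 2 ≤ d * R ^ 2 := by
    refine (Finset.sum_le_sum fun δ _ => sq_le_sq' (abs_le.1 (hy δ)).1 (abs_le.1 (hy δ)).2).trans ?_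
    simp
  unfold limitDensity
  constructor
  · gcongr; linarith
  · gcongr; linarith

/-- Dominated convergence on the rescaled box; the filter must be countably generated for it. -/
theorem tendsto_latticeMass_div_sub [l.IsCountablyGenerated] (J : Matrix (Fin d) (Fin d) ℝ)
    (hN : ∀ δ, Tendsto (fun i => N i δ) l atTop)
    (hr : ∀ δ, Tendsto (fun i => sqrtFraction (N i) δ) l (𝓝 (r δ))) (hr1 : ∀ δ, |r δ| ≤ 1)
    (hbox : ∀ᶠ i in l, ∀ δ, 0 < L i δ ∧ -R ≤ lo i δ ∧ lo i δ + L i δ ≤ R)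
    (hLN : ∀ δ, Tendsto (fun i => L i δ * √(N i δ : ℝ)) l atTop)
    (hK : ∀ᶠ i in l, ∀ δ, Set.Ioo (lo i δ) (lo i δ + L i δ) ⊆ K i δ)
    (hK' : ∀ᶠ i in l, ∀ δ, K i δ ⊆ Set.Icc (lo i δ) (lo i δ + L i δ)) :
    Tendsto (fun i => latticeMass J (N i) (Set.univ.pi (K i)) / (∏ δ, L i δ) -
      (1 / √(2 * Real.pi)) ^ d *
        ∫ t in Set.Icc (0 : Fin d → ℝ) 1, limitDensity J r (fun δ => lo i δ + L i δ * t δ))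
      l (𝓝 0) := by
  classical
  obtain ⟨B, hB0, hB⟩ := exists_sqrt_mul_fairWeight_le
  have hN0 : ∀ᶠ i in l, ∀ δ, 0 < N i δ :=
    eventually_all.2 fun δ => (hN δ).eventually_gt_atTop 0
  have hcont (i : ι) : Continuous fun t : Fin d → ℝ =>
      limitDensity J r (fun δ => lo i δ + L i δ * t δ) :=
    continuous_limitDensity_comp J r (by fun_prop)
  set c₀ := (1 / √(2 * Real.pi)) ^ d with hc₀
  have hc₀' : 0 ≤ c₀ := by positivity
  set F : ι → (Fin d → ℝ) → ℝ := fun i t =>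
    stepDensity J (N i) (Set.univ.pi (K i)) (fun δ => lo i δ + L i δ * t δ) -
      (Set.Icc (0 : Fin d → ℝ) 1).indicator
        (fun t => c₀ * limitDensity J r (fun δ => lo i δ + L i δ * t δ)) t with hF
  set M := Real.exp ((∑ δ, ∑ γ, |J δ γ|) * R ^ 2 / 2) with hM
  have hsub : ∀ᶠ i in l, ∀ t ∈ Set.Icc (0 : Fin d → ℝ) 1, ∀ δ, |lo i δ + L i δ * t δ| ≤ R := by
    filter_upwards [hbox] with i hi t ht δ
    obtain ⟨h1, h2, h3⟩ := hi δ
    have h4 : 0 ≤ t δ := ht.1 δ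
    have h5 : t δ ≤ 1 := ht.2 δ
    rw [abs_le]
    constructor <;> nlinarith
  have hindint (i : ι) : Integrable ((Set.Icc (0 : Fin d → ℝ) 1).indicator
        (fun t => c₀ * limitDensity J r (fun δ => lo i δ + L i δ * t δ))) :=
    (integrable_indicator_iff measurableSet_Icc).2
      (((hcont i).const_mul c₀).continuousOn.integrableOn_compact isCompact_Icc)
  have hmain : Tendsto (fun i => ∫ t, F i t) l (𝓝 (∫ _ : Fin d → ℝ, (0 : ℝ))) := by
    -- The cube `[0, 2] ^ d` suffices because the overhang of one cell is eventually at most the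
    -- side of the box.
    refine tendsto_integral_filter_of_dominated_convergence
      ((Set.Icc (0 : Fin d → ℝ) 2).indicator fun _ => B ^ d * M + c₀ * M) ?_ ?_ ?_ ?_
    · filter_upwards [hN0, hbox] with i h1 h2
      exact ((integrable_and_integral_stepDensity J h1 _ fun δ => (h2 δ).1).1.sub
        (hindint i)).aestronglyMeasurable
    · filter_upwards [hN0, hbox, hK', hsub, eventually_all.2 fun δ =>
        (hLN δ).eventually_ge_atTop 2] with i h1 h2 h3 h4 h5
      refine ae_of_all _ fun t => ?_
      have hR : ∀ x ∈ Set.univ.pi (K i), ∀ δ, |x δ| ≤ R := fun x hx δ => by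
        have := h3 δ (hx δ (Set.mem_univ δ))
        have h6 := h2 δ
        rw [abs_le]
        constructor <;> linarith [this.1, this.2]
      have hstep : |stepDensity J (N i) (Set.univ.pi (K i)) (fun δ => lo i δ + L i δ * t δ)| ≤
          (Set.Icc (0 : Fin d → ℝ) 2).indicator (fun _ => B ^ d * M) t := by
        by_cases h0 : stepDensity J (N i) (Set.univ.pi (K i)) (fun δ => lo i δ + L i δ * t δ) = 0
        · rw [h0, abs_zero]
          exact Set.indicator_nonneg (fun _ _ => by positivity) _
        · have hb := bounds_of_stepDensity_ne_zero h1 (fun δ => (h2 δ).1) h3 h0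
          rw [Set.indicator_of_mem]
          · exact abs_stepDensity_le J hB hR _
          · refine ⟨fun δ => (hb δ).1, fun δ => (hb δ).2.trans ?_⟩
            have h6 : 2 / (L i δ * √(N i δ : ℝ)) ≤ 1 :=
              div_le_one_of_le₀ (h5 δ) (zero_le_two.trans (h5 δ))
            simp only [Pi.ofNat_apply]
            linarith
      have hlim : |(Set.Icc (0 : Fin d → ℝ) 1).indicator
          (fun t => c₀ * limitDensity J r (fun δ => lo i δ + L i δ * t δ)) t| ≤
          (Set.Icc (0 : Fin d → ℝ) 2).indicator (fun _ => c₀ * M) t := by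
        by_cases ht : t ∈ Set.Icc (0 : Fin d → ℝ) 1
        · have ht2 : t ∈ Set.Icc (0 : Fin d → ℝ) 2 :=
            ⟨ht.1, fun δ => (ht.2 δ).trans (by simp)⟩
          rw [Set.indicator_of_mem ht, Set.indicator_of_mem ht2, abs_mul, abs_of_nonneg hc₀',
            abs_of_pos (limitDensity_pos _ _ _)]
          gcongr
          exact (limitDensity_bounds J hr1 (h4 t ht)).2
        · rw [Set.indicator_of_notMem ht, abs_zero]
          exact Set.indicator_nonneg (fun _ _ => by positivity) _
      rw [hF, Real.norm_eq_abs]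
      refine (abs_sub _ _).trans ((add_le_add hstep hlim).trans (le_of_eq ?_))
      by_cases ht2 : t ∈ Set.Icc (0 : Fin d → ℝ) 2 <;> simp [ht2]
    · exact (integrable_indicator_iff measurableSet_Icc).2
        (continuous_const.continuousOn.integrableOn_compact isCompact_Icc)
    -- Off these hyperplanes `t` is interior, where the local limit theorem applies, or outside the
    -- closed cube, where the step function vanishes once the overhang is small enough.
    · have hnull : ∀ᵐ t : Fin d → ℝ, ∀ δ, t δ ≠ 0 ∧ t δ ≠ 1 := by
        refine ae_all_iff.2 fun δ => ?_
        have h0 (x : ℝ) : ∀ᵐ t : Fin d → ℝ, t δ ≠ x := by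
          have : volume {t : Fin d → ℝ | t δ = x} = 0 :=
            Measure.pi_hyperplane (fun _ => (volume : Measure ℝ)) δ x
          rw [ae_iff]
          simpa using this
        filter_upwards [h0 0, h0 1] with t h1 h2 using ⟨h1, h2⟩
      filter_upwards [hnull] with t ht
      by_cases hin : ∀ δ, t δ ∈ Set.Ioo 0 1
      · have hmem : t ∈ Set.Icc (0 : Fin d → ℝ) 1 :=
          ⟨fun δ => (hin δ).1.le, fun δ => (hin δ).2.le⟩
        simp only [hF, Set.indicator_of_mem hmem]
        exact tendsto_stepDensity_sub_of_interior J hN hr hbox hLN hK hin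
      · obtain ⟨δ, hδ⟩ := not_forall.1 hin
        have hnot : t ∉ Set.Icc (0 : Fin d → ℝ) 1 := fun h =>
          hδ ⟨lt_of_le_of_ne (h.1 δ) (ht δ).1.symm, lt_of_le_of_ne (h.2 δ) (ht δ).2⟩
        simp only [hF, Set.indicator_of_notMem hnot, sub_zero]
        refine tendsto_const_nhds.congr' ?_
        have h6 : ∀ᶠ i in l, 1 < t δ → 2 / (L i δ * √(N i δ : ℝ)) < t δ - 1 := by
          by_cases h1 : 1 < t δ
          · filter_upwards [((hLN δ).const_div_atTop 2).eventually_lt_const (sub_pos.2 h1)] with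
              i hi _ using hi
          · exact Eventually.of_forall fun i h => absurd h h1
        filter_upwards [hN0, hbox, hK', h6] with i h1 h2 h3 h4
        by_contra h0
        have hb := bounds_of_stepDensity_ne_zero h1 (fun δ => (h2 δ).1) h3 (Ne.symm h0) δ
        rcases lt_or_gt_of_ne (ht δ).2 with h7 | h7
        · exact hδ ⟨lt_of_le_of_ne hb.1 (ht δ).1.symm, h7⟩
        · linarith [h4 h7, hb.2]
  rw [integral_zero] at hmain
  refine hmain.congr' ?_
  filter_upwards [hN0, hbox] with i h1 h2
  have h3 := integrable_and_integral_stepDensity J h1 (Set.univ.pi (K i)) (lo := lo i)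
    (L := L i) fun δ => (h2 δ).1
  simp only [hF]
  rw [integral_sub h3.1 (hindint i), h3.2, integral_indicator measurableSet_Icc, integral_const_mul]

/-- Along a sequence of boxes whose side lengths are large compared to the lattice spacing, the
lattice mass is asymptotic to a multiple of the mass of the limiting density. -/
theorem tendsto_latticeMass_div_setIntegral [l.IsCountablyGenerated]
    (J : Matrix (Fin d) (Fin d) ℝ)
    (hN : ∀ δ, Tendsto (fun i => N i δ) l atTop)
    (hr : ∀ δ, Tendsto (fun i => sqrtFraction (N i) δ) l (𝓝 (r δ))) (hr1 : ∀ δ, |r δ| ≤ 1)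
    (hbox : ∀ᶠ i in l, ∀ δ, 0 < L i δ ∧ -R ≤ lo i δ ∧ lo i δ + L i δ ≤ R)
    (hLN : ∀ δ, Tendsto (fun i => L i δ * √(N i δ : ℝ)) l atTop)
    (hK : ∀ᶠ i in l, ∀ δ, Set.Ioo (lo i δ) (lo i δ + L i δ) ⊆ K i δ)
    (hK' : ∀ᶠ i in l, ∀ δ, K i δ ⊆ Set.Icc (lo i δ) (lo i δ + L i δ)) :
    Tendsto (fun i => latticeMass J (N i) (Set.univ.pi (K i)) /
      ∫ y in Set.univ.pi (K i), limitDensity J r y) l (𝓝 ((1 / √(2 * Real.pi)) ^ d)) := by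
  have key := tendsto_latticeMass_div_sub J hN hr hr1 hbox hLN hK hK'
  set c₀ := (1 / √(2 * Real.pi)) ^ d with hc₀
  set D : ι → ℝ := fun i =>
    ∫ t in Set.Icc (0 : Fin d → ℝ) 1, limitDensity J r (fun δ => lo i δ + L i δ * t δ) with hD
  set ε := Real.exp (-((∑ δ, ∑ γ, |J δ γ|) * R ^ 2 + d * R ^ 2) / 2) with hε
  have hε0 : 0 < ε := Real.exp_pos _
  -- The density averages stay away from zero, which upgrades a vanishing difference to a convergent
  -- quotient.
  have hDε : ∀ᶠ i in l, ε ≤ D i := by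
    filter_upwards [hbox] with i hi
    have hcont : Continuous fun t : Fin d → ℝ =>
        limitDensity J r (fun δ => lo i δ + L i δ * t δ) :=
      continuous_limitDensity_comp J r (by fun_prop)
    have hvol : volume.real (Set.Icc (0 : Fin d → ℝ) 1) = 1 := by
      rw [measureReal_def, Real.volume_Icc_pi]
      simp
    calc ε = ∫ t in Set.Icc (0 : Fin d → ℝ) 1, ε := by rw [setIntegral_const, hvol, one_smul]
      _ ≤ D i := by
        refine setIntegral_mono_on (continuous_const.continuousOn.integrableOn_compact isCompact_Icc)
          (hcont.continuousOn.integrableOn_compact isCompact_Icc) measurableSet_Icc fun t ht => ?_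
        refine (limitDensity_bounds J hr1 fun δ => ?_).1
        obtain ⟨h1, h2, h3⟩ := hi δ
        have h4 : 0 ≤ t δ := ht.1 δ
        have h5 : t δ ≤ 1 := ht.2 δ
        rw [abs_le]
        constructor <;> nlinarith
  have hq : Tendsto (fun i => (latticeMass J (N i) (Set.univ.pi (K i)) / (∏ δ, L i δ) - c₀ * D i) /
      D i + c₀) l (𝓝 c₀) := by
    have : Tendsto (fun i => (latticeMass J (N i) (Set.univ.pi (K i)) / (∏ δ, L i δ) - c₀ * D i) /
        D i) l (𝓝 0) := by
      refine squeeze_zero_norm' (a := fun i =>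
        |latticeMass J (N i) (Set.univ.pi (K i)) / (∏ δ, L i δ) - c₀ * D i| / ε) ?_
        (by simpa using key.abs.div_const ε)
      filter_upwards [hDε] with i hi
      rw [norm_div, Real.norm_eq_abs, Real.norm_of_nonneg (hε0.le.trans hi)]
      gcongr
    simpa using this.add_const c₀
  refine hq.congr' ?_
  filter_upwards [hDε, hbox, hK, hK'] with i h1 h2 h3 h4
  have hmeas : Measurable (limitDensity J r) :=
    (continuous_limitDensity_comp J r continuous_id).measurable
  rw [setIntegral_pi_eq (fun δ => (h2 δ).1) h3 h4 hmeas]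
  have h5 : 0 < ∏ δ, L i δ := Finset.prod_pos fun δ _ => (h2 δ).1
  have h6 : D i ≠ 0 := (hε0.trans_le h1).ne'
  change _ = _ / ((∏ δ, L i δ) * D i)
  field_simp
  ring

end BoxSequence

/-! ### Tails, normalising constants and probabilities -/

theorem abs_scaledForm_sub_le (J : Matrix (Fin d) (Fin d) ℝ) (r s x : Fin d → ℝ) :
    |scaledForm J r x - scaledForm J s x| ≤
      (∑ δ, ∑ γ, |J δ γ * (r δ * r γ - s δ * s γ)|) * ∑ δ, x δ ^ 2 := by
  have hx (δ γ : Fin d) : |x δ * x γ| ≤ ∑ δ, x δ ^ 2 := by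
    have h (δ : Fin d) : x δ ^ 2 ≤ ∑ δ, x δ ^ 2 :=
      Finset.single_le_sum (f := fun δ => x δ ^ 2) (fun _ _ => sq_nonneg _) (Finset.mem_univ δ)
    rw [abs_le]
    constructor <;> nlinarith [h δ, h γ, sq_nonneg (x δ + x γ), sq_nonneg (x δ - x γ)]
  unfold scaledForm
  rw [← Finset.sum_sub_distrib, Finset.sum_mul]
  refine (Finset.abs_sum_le_sum_abs _ _).trans (Finset.sum_le_sum fun δ _ => ?_)
  rw [← Finset.sum_sub_distrib, Finset.sum_mul]
  refine (Finset.abs_sum_le_sum_abs _ _).trans (Finset.sum_le_sum fun γ _ => ?_)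
  rw [show J δ γ * (r δ * x δ * (r γ * x γ)) - J δ γ * (s δ * x δ * (s γ * x γ)) =
    J δ γ * (r δ * r γ - s δ * s γ) * (x δ * x γ) by ring, abs_mul]
  exact mul_le_mul_of_nonneg_left (hx δ γ) (abs_nonneg _)

/-- The forms converge uniformly relative to `∑ x δ ^ 2`, so half of the gap survives at finite
size, for all `x` simultaneously. -/
theorem eventually_scaledForm_le {ι : Type*} {l : Filter ι} (J : Matrix (Fin d) (Fin d) ℝ)
    {s : ι → Fin d → ℝ} {r : Fin d → ℝ} (hs : ∀ δ, Tendsto (fun i => s i δ) l (𝓝 (r δ))) {c : ℝ}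
    (hc : 0 < c) (hr : ∀ x : Fin d → ℝ, scaledForm J r x ≤ (1 - c) * ∑ δ, x δ ^ 2) :
    ∀ᶠ i in l, ∀ x : Fin d → ℝ, scaledForm J (s i) x ≤ (1 - c / 2) * ∑ δ, x δ ^ 2 := by
  have h0 : Tendsto (fun i => ∑ δ, ∑ γ, |J δ γ * (s i δ * s i γ - r δ * r γ)|) l (𝓝 0) := by
    have : Tendsto (fun i => ∑ δ, ∑ γ, |J δ γ * (s i δ * s i γ - r δ * r γ)|) l
        (𝓝 (∑ δ, ∑ γ, |J δ γ * (r δ * r γ - r δ * r γ)|)) :=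
      tendsto_finsetSum _ fun δ _ => tendsto_finsetSum _ fun γ _ =>
        ((((hs δ).mul (hs γ)).sub_const _).const_mul _).abs
    simpa using this
  filter_upwards [h0.eventually_le_const (half_pos hc)] with i hi x
  have h1 := (le_abs_self _).trans (abs_scaledForm_sub_le J (s i) r x)
  have h2 : 0 ≤ ∑ δ, x δ ^ 2 := Finset.sum_nonneg fun _ _ => sq_nonneg _
  nlinarith [hr x, mul_le_mul_of_nonneg_right hi h2]

/-- The part of the mass outside of a large box is uniformly small. -/
theorem latticeMass_univ_le (J : Matrix (Fin d) (Fin d) ℝ) {N : Fin d → ℕ} {c B R : ℝ}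
    (hR : 0 ≤ R) (hc : 0 < c)
    (hJ : ∀ x : Fin d → ℝ, scaledForm J (sqrtFraction N) x ≤ (1 - c / 2) * ∑ δ, x δ ^ 2)
    (hB : ∀ N : ℕ, ∑ k ∈ Finset.range (N + 1),
      fairWeight N k * Real.exp ((1 - c / 4) * latticePoint N k ^ 2 / 2) ≤ B) :
    latticeMass J N Set.univ ≤ latticeMass J N (Set.univ.pi fun _ => Set.Icc (-R) R) +
      Real.exp (-(c * R ^ 2 / 8)) * B ^ d := by
  classical
  -- Half of the remaining gap `c / 2` is spent on decay outside the box, giving `exp (-(c R ^ 2 /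
  -- 8))`; the other half leaves the coefficient `1 - c / 4`, whose exponential factorises over the
  -- groups.
  have hprod : ∑ k ∈ countBox N, ∏ δ, (fairWeight (N δ) (k δ) *
      Real.exp ((1 - c / 4) * latticePoint (N δ) (k δ) ^ 2 / 2)) ≤ B ^ d := by
    rw [countBox, ← Finset.prod_univ_sum (fun δ => Finset.range (N δ + 1)) fun δ k =>
      fairWeight (N δ) k * Real.exp ((1 - c / 4) * latticePoint (N δ) k ^ 2 / 2)]
    refine (Finset.prod_le_prod (fun δ _ => Finset.sum_nonneg fun k _ =>
      mul_nonneg (fairWeight_nonneg _ _) (Real.exp_pos _).le) fun δ _ => hB (N δ)).trans ?_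
    simp
  refine le_trans ?_ (add_le_add_right
    (mul_le_mul_of_nonneg_left hprod (Real.exp_pos (-(c * R ^ 2 / 8))).le) _)
  rw [latticeMass, latticeMass, Finset.mul_sum, ← Finset.sum_add_distrib]
  refine Finset.sum_le_sum fun k _ => ?_
  rw [Set.indicator_univ]
  set x := magnetizationPoint N k with hx
  have hw : 0 ≤ ∏ δ, fairWeight (N δ) (k δ) := Finset.prod_nonneg fun _ _ => fairWeight_nonneg _ _
  by_cases hmem : x ∈ Set.univ.pi fun _ : Fin d => Set.Icc (-R) R
  · rw [Set.indicator_of_mem hmem, le_add_iff_nonneg_right]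
    exact mul_nonneg (Real.exp_pos _).le (Finset.prod_nonneg fun _ _ =>
      mul_nonneg (fairWeight_nonneg _ _) (Real.exp_pos _).le)
  · rw [Set.indicator_of_notMem hmem, zero_add, Finset.prod_mul_distrib, ← Real.exp_sum,
      mul_left_comm, ← Real.exp_add, latticeWeight]
    refine mul_le_mul_of_nonneg_left (Real.exp_le_exp.2 ?_) hw
    have h1 : R ^ 2 ≤ ∑ δ, x δ ^ 2 := by
      simp only [Set.mem_pi, Set.mem_univ, forall_true_left, not_forall] at hmem
      obtain ⟨δ, hδ⟩ := hmem
      refine le_trans ?_ (Finset.single_le_sum (f := fun δ => x δ ^ 2) (fun _ _ => sq_nonneg _)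
        (Finset.mem_univ δ))
      rw [Set.mem_Icc, ← abs_le, not_le] at hδ
      exact sq_le_sq.2 (by rw [abs_of_nonneg hR]; exact hδ.le)
    have h2 : ∑ δ, (1 - c / 4) * latticePoint (N δ) (k δ) ^ 2 / 2 =
        (1 - c / 4) / 2 * ∑ δ, x δ ^ 2 := by
      rw [Finset.mul_sum]
      refine Finset.sum_congr rfl fun δ _ => ?_
      rw [hx, magnetizationPoint]; ring
    rw [h2]
    nlinarith [hJ x]

theorem latticeMass_mono (J : Matrix (Fin d) (Fin d) ℝ) (N : Fin d → ℕ) {S T : Set (Fin d → ℝ)}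
    (h : S ⊆ T) : latticeMass J N S ≤ latticeMass J N T :=
  Finset.sum_le_sum fun _ _ => Set.indicator_le_indicator_of_subset h
    (fun _ => latticeWeight_nonneg _ _ _) _

theorem measurableSet_setOf_forall_mem {K : Fin d → Set ℝ} (hK : ∀ δ, MeasurableSet (K δ)) :
    MeasurableSet {x : EuclideanSpace ℝ (Fin d) | ∀ δ, x δ ∈ K δ} := by
  have : {x : EuclideanSpace ℝ (Fin d) | ∀ δ, x δ ∈ K δ} = ⋂ δ, (fun x => x δ) ⁻¹' K δ := by
    ext x; simp
  rw [this]
  exact MeasurableSet.iInter fun δ => (by fun_prop : Measurable fun x : EuclideanSpace ℝ (Fin d) =>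
    x δ) (hK δ)

theorem tendsto_real_box (μ : Measure (EuclideanSpace ℝ (Fin d))) [IsProbabilityMeasure μ] :
    Tendsto (fun n : ℕ => μ.real {x | ∀ δ, x δ ∈ Set.Icc (-(n : ℝ)) n}) atTop (𝓝 1) := by
  have hmono : Monotone fun n : ℕ =>
      {x : EuclideanSpace ℝ (Fin d) | ∀ δ, x δ ∈ Set.Icc (-(n : ℝ)) n} := by
    intro n m hnm x hx δ
    have h : (n : ℝ) ≤ m := by exact_mod_cast hnm
    exact Set.Icc_subset_Icc (neg_le_neg h) h (hx δ)
  have hunion : (⋃ n : ℕ, {x : EuclideanSpace ℝ (Fin d) | ∀ δ, x δ ∈ Set.Icc (-(n : ℝ)) n}) =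
      Set.univ := by
    refine Set.eq_univ_of_forall fun x => Set.mem_iUnion.2 ?_
    obtain ⟨n, hn⟩ := exists_nat_ge ‖x‖
    exact ⟨n, fun δ => abs_le.1 (((PiLp.norm_apply_le x δ)).trans hn)⟩
  have := tendsto_measure_iUnion_atTop (μ := μ) hmono
  rw [hunion, measure_univ] at this
  exact (ENNReal.tendsto_toReal ENNReal.one_ne_top).comp this

section Sequence

variable {ι : Type*} {l : Filter ι} [l.IsCountablyGenerated] {N : ι → Fin d → ℕ} {r : Fin d → ℝ}
  {J C Q : Matrix (Fin d) (Fin d) ℝ}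

/-- The convergence of the normalising constants. -/
theorem tendsto_latticeMass_univ
    (hN : ∀ δ, Tendsto (fun i => N i δ) l atTop)
    (hr : ∀ δ, Tendsto (fun i => sqrtFraction (N i) δ) l (𝓝 (r δ))) (hr1 : ∀ δ, |r δ| ≤ 1)
    {c : ℝ} (hc : 0 < c) (hc1 : c ≤ 1)
    (hJ : ∀ x : Fin d → ℝ, scaledForm J r x ≤ (1 - c) * ∑ δ, x δ ^ 2)
    {μ : Measure (EuclideanSpace ℝ (Fin d))} [IsProbabilityMeasure μ] {κ : ℝ} (hκ : 0 < κ)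
    (hμ : ∀ K : Fin d → Set ℝ, (∀ δ, MeasurableSet (K δ)) → μ.real {x | ∀ δ, x δ ∈ K δ} =
      κ * ∫ y in Set.univ.pi K, limitDensity J r y) :
    Tendsto (fun i => latticeMass J (N i) Set.univ) l (𝓝 ((1 / √(2 * Real.pi)) ^ d / κ)) := by
  -- The assumption `c ≤ 1` keeps `θ` nonnegative and `0 < c` keeps it below one.
  obtain ⟨B, hB0, hB⟩ := exists_sum_fairWeight_mul_exp_sq_le (θ := 1 - c / 4) (by linarith)
    (by linarith)
  set z := (1 / √(2 * Real.pi)) ^ d with hz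
  have hbox (R : ℝ) (hR : 0 < R) : Tendsto (fun i =>
      latticeMass J (N i) (Set.univ.pi fun _ => Set.Icc (-R) R)) l
        (𝓝 (z / κ * μ.real {x | ∀ δ, x δ ∈ Set.Icc (-R) R})) := by
    have hNs (δ : Fin d) : Tendsto (fun i => √(N i δ : ℝ)) l atTop :=
      Real.tendsto_sqrt_atTop.comp (tendsto_natCast_atTop_atTop.comp (hN δ))
    have h := tendsto_latticeMass_div_setIntegral (lo := fun _ _ => -R) (L := fun _ _ => 2 * R)
      (K := fun _ _ => Set.Icc (-R) R) (R := R) J hN hr hr1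
      (Eventually.of_forall fun i δ => ⟨by linarith, by linarith, by linarith⟩)
      (fun δ => (hNs δ).const_mul_atTop (by linarith))
      (Eventually.of_forall fun i δ => by
        rw [show -R + 2 * R = R by ring]; exact Set.Ioo_subset_Icc_self)
      (Eventually.of_forall fun i δ => by rw [show -R + 2 * R = R by ring])
    have hI : 0 < ∫ y in Set.univ.pi fun _ : Fin d => Set.Icc (-R) R, limitDensity J r y := by
      have hne : volume (Set.univ.pi fun _ : Fin d => Set.Icc (-R) R) ≠ 0 := by
        rw [volume_pi_pi, Finset.prod_ne_zero_iff]
        intro δ _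
        rw [Real.volume_Icc]
        exact (ENNReal.ofReal_pos.2 (by linarith)).ne'
      have : NeZero (volume.restrict (Set.univ.pi fun _ : Fin d => Set.Icc (-R) R)) :=
        ⟨fun h0 => hne (Measure.restrict_eq_zero.1 h0)⟩
      exact integral_exp_pos ((continuous_limitDensity_comp J r
        continuous_id).continuousOn.integrableOn_compact (isCompact_univ_pi fun _ => isCompact_Icc))
    rw [hμ _ fun _ => measurableSet_Icc]
    have h2 := h.mul_const (∫ y in Set.univ.pi fun _ : Fin d => Set.Icc (-R) R, limitDensity J r y)
    rw [show z / κ * (κ * ∫ y in Set.univ.pi fun _ : Fin d => Set.Icc (-R) R, limitDensity J r y) =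
      z * ∫ y in Set.univ.pi fun _ : Fin d => Set.Icc (-R) R, limitDensity J r y by field_simp]
    exact h2.congr fun i => div_mul_cancel₀ _ hI.ne'
  have htail : Tendsto (fun n : ℕ => Real.exp (-(c * (n : ℝ) ^ 2 / 8)) * B ^ d) atTop (𝓝 0) := by
    have h1 : Tendsto (fun n : ℕ => c * (n : ℝ) ^ 2 / 8) atTop atTop :=
      (((tendsto_pow_atTop two_ne_zero).comp tendsto_natCast_atTop_atTop).const_mul_atTop
        hc).atTop_div_const (by norm_num)
    simpa using (Real.tendsto_exp_neg_atTop_nhds_zero.comp h1).mul_const (B ^ d)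
  have hlim : Tendsto (fun n : ℕ => z / κ * μ.real {x | ∀ δ, x δ ∈ Set.Icc (-(n : ℝ)) n}) atTop
      (𝓝 (z / κ)) := by
    simpa using (tendsto_real_box μ).const_mul (z / κ)
  rw [Metric.tendsto_nhds]
  intro ε hε
  -- A fixed large box makes both the lattice tail and the Gaussian tail small; only then does the
  -- system size grow.
  obtain ⟨n, hn1, hn2, hn0⟩ := ((htail.eventually_lt_const (by positivity : 0 < ε / 3)).and
    ((Metric.tendsto_nhds.1 hlim (ε / 3) (by positivity)).and (eventually_gt_atTop 0))).exists
  have hn0' : (0 : ℝ) < n := by exact_mod_cast hn0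
  filter_upwards [Metric.tendsto_nhds.1 (hbox n hn0') (ε / 3) (by positivity),
    eventually_scaledForm_le J hr hc hJ] with i h1 h2
  have h3 := latticeMass_univ_le J hn0'.le hc h2 hB
  have h4 := latticeMass_mono J (N i) (Set.subset_univ (Set.univ.pi fun _ => Set.Icc (-(n : ℝ)) n))
  rw [Real.dist_eq, abs_lt] at *
  constructor <;> linarith [h1.1, h1.2, hn2.1, hn2.2]

/-- Along a sequence of boxes whose side lengths are large compared to the lattice spacing, the
Curie-Weiss probabilities are asymptotic to the limiting probabilities. -/
theorem tendsto_curieWeissMeasure_div {lo L : ι → Fin d → ℝ} {K : ι → Fin d → Set ℝ} {R : ℝ}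
    (hN : ∀ δ, Tendsto (fun i => N i δ) l atTop)
    (hr : ∀ δ, Tendsto (fun i => sqrtFraction (N i) δ) l (𝓝 (r δ))) (hr1 : ∀ δ, |r δ| ≤ 1)
    (hC : C.PosDef) (hCQ : C * Q = 1)
    (hQ : ∀ x : Fin d → ℝ, x ⬝ᵥ Q *ᵥ x = ∑ δ, x δ ^ 2 - scaledForm J r x)
    (hbox : ∀ᶠ i in l, ∀ δ, 0 < L i δ ∧ -R ≤ lo i δ ∧ lo i δ + L i δ ≤ R)
    (hLN : ∀ δ, Tendsto (fun i => L i δ * √(N i δ : ℝ)) l atTop)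
    (hK : ∀ᶠ i in l, ∀ δ, Set.Ioo (lo i δ) (lo i δ + L i δ) ⊆ K i δ)
    (hK' : ∀ᶠ i in l, ∀ δ, K i δ ⊆ Set.Icc (lo i δ) (lo i δ + L i δ))
    (hKm : ∀ᶠ i in l, ∀ δ, MeasurableSet (K i δ)) :
    Tendsto (fun i => (curieWeissMeasure J (N i)).real
        {x | rescaledMagnetization x ∈ {y : EuclideanSpace ℝ (Fin d) | ∀ δ, y δ ∈ K i δ}} /
      (multivariateGaussian 0 C).real {y | ∀ δ, y δ ∈ K i δ}) l (𝓝 1) := by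
  have hQ' : Q = C⁻¹ := (Matrix.inv_eq_right_inv hCQ).symm
  obtain ⟨c, hc, hcQ⟩ := exists_mul_sum_sq_le (hQ' ▸ hC.inv)
  obtain ⟨κ, hκ, hκG⟩ := exists_multivariateGaussian_real_eq hC hCQ
  have hμ (K : Fin d → Set ℝ) (hK : ∀ δ, MeasurableSet (K δ)) :
      (multivariateGaussian 0 C).real {x | ∀ δ, x δ ∈ K δ} =
        κ * ∫ y in Set.univ.pi K, limitDensity J r y := by
    rw [hκG _ (measurableSet_setOf_forall_mem hK)]
    have : WithLp.toLp 2 ⁻¹' {x : EuclideanSpace ℝ (Fin d) | ∀ δ, x δ ∈ K δ} = Set.univ.pi K := by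
      ext x; simp
    rw [this]
    congr 1
    refine integral_congr_ae (ae_of_all _ fun y => ?_)
    simp only [limitDensity, hQ]
    congr 1
    ring
  have hZ := tendsto_latticeMass_univ (J := J) (c := min c 1) hN hr hr1 (by positivity) (min_le_right _ _)
    (fun x => by
      have h1 := hcQ x
      rw [hQ] at h1
      have h2 : 0 ≤ ∑ δ, x δ ^ 2 := Finset.sum_nonneg fun _ _ => sq_nonneg _
      nlinarith [mul_le_mul_of_nonneg_right (min_le_left c 1) h2]) hκ hμ
  have hM := tendsto_latticeMass_div_setIntegral J hN hr hr1 hbox hLN hK hK'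
  set z := (1 / √(2 * Real.pi)) ^ d with hz
  have hz0 : 0 < z := by positivity
  have h := hM.div (hZ.mul_const κ) (by positivity)
  rw [div_mul_cancel₀ _ hκ.ne', div_self hz0.ne'] at h
  refine h.congr' ?_
  filter_upwards [hKm] with i hi
  change _ = (curieWeissMeasure J (N i)).real {x | rescaledMagnetization x ∈
    {y : EuclideanSpace ℝ (Fin d) | ∀ δ, y δ ∈ K i δ}} / _
  rw [curieWeissMeasure_real, hμ _ hi, Pi.div_apply, div_div, div_div]
  congr 1
  ring

end Sequence

/-! ### Interval end points and uniformity over boxes -/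

/-- A bounded order-connected set of real numbers lies between an open and a closed interval with
the same end points. -/
theorem ordConnected_bounds {K : Set ℝ} (hK : K.OrdConnected) {a b m : ℝ}
    (hab : K ⊆ Set.Icc a b) (hm : 0 < m) (hvol : ENNReal.ofReal m ≤ volume K) :
    Set.Ioo (sInf K) (sSup K) ⊆ K ∧ K ⊆ Set.Icc (sInf K) (sSup K) ∧ a ≤ sInf K ∧ sSup K ≤ b ∧
      m ≤ sSup K - sInf K := by
  have hne : K.Nonempty := by
    rw [Set.nonempty_iff_ne_empty]
    rintro rfl
    simp [hm.not_ge] at hvol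
  have hbb : BddBelow K := ⟨a, fun x hx => (hab hx).1⟩
  have hba : BddAbove K := ⟨b, fun x hx => (hab hx).2⟩
  have hsub : K ⊆ Set.Icc (sInf K) (sSup K) := fun x hx => ⟨csInf_le hbb hx, le_csSup hba hx⟩
  refine ⟨fun x hx => ?_, hsub, le_csInf hne fun x hx => (hab hx).1,
    csSup_le hne fun x hx => (hab hx).2, ?_⟩
  · obtain ⟨u, hu, hux⟩ := exists_lt_of_csInf_lt hne hx.1
    obtain ⟨v, hv, hxv⟩ := exists_lt_of_lt_csSup hne hx.2
    exact hK.out hu hv ⟨hux.le, hxv.le⟩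
  · have h := hvol.trans (measure_mono hsub)
    rw [Real.volume_Icc] at h
    by_contra! hlt
    exact absurd h (not_le.2 ((ENNReal.ofReal_lt_ofReal_iff hm).2 hlt))

/-- A point of one factor is completed to a point of the product by choosing points in the other
factors, hence the nonemptiness. -/
theorem subset_Icc_of_subset_closedBox {K : Fin d → Set ℝ} {a b : Fin d → ℝ}
    (h : {x : EuclideanSpace ℝ (Fin d) | ∀ δ, x δ ∈ K δ} ⊆ closedBox a b)
    (hne : ∀ δ, (K δ).Nonempty) (δ : Fin d) : K δ ⊆ Set.Icc (a δ) (b δ) := by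
  intro x hx
  choose p hp using hne
  have := h (show WithLp.toLp 2 (Function.update p δ x) ∈
    {x : EuclideanSpace ℝ (Fin d) | ∀ δ, x δ ∈ K δ} from fun γ => by
      by_cases hγ : γ = δ
      · subst hγ; simpa using hx
      · simpa [Function.update_of_ne hγ] using hp γ) δ
  simpa using this

end CurieWeiss

theorem mainTheorem3 {d : ℕ}
    -- group sizes, depending on the total number `n` of spins, and asymptotic group fractions
    (N : ℕ → Fin d → ℕ)
    (hN_pos : ∀ n, d ≤ n → ∀ δ, 0 < N n δ)
    (hN_sum : ∀ n, d ≤ n → ∑ δ, N n δ = n)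
    (α : Fin d → ℝ)
    (hα : ∀ δ, Tendsto (fun n : ℕ => (N n δ : ℝ) / (n : ℝ)) atTop (𝓝 (α δ)))
    -- coupling matrix in the high-temperature regime and limiting covariance matrix
    (J C : Matrix (Fin d) (Fin d) ℝ)
    (hJC : CurieWeiss.HighTemperature α J C)
    -- the spins
    {Ω : ℕ → Type*} [∀ n, MeasurableSpace (Ω n)]
    (P : ∀ n, Measure (Ω n)) [∀ n, IsProbabilityMeasure (P n)]
    (X : ∀ n, Ω n → CurieWeiss.SpinConfig (N n))
    (hX : ∀ n, d ≤ n → HasLaw (X n) (CurieWeiss.curieWeissMeasure J (N n)) (P n))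
    -- the box and the minimal side lengths
    (a b : Fin d → ℝ) (hab : ∀ δ, a δ < b δ)
    (m : ℕ → Fin d → ℝ)
    (hm : ∀ δ, Tendsto (fun n => m n δ * √(N n δ : ℝ)) atTop atTop) :
    Tendsto
      (fun n => ⨆ I ∈ CurieWeiss.intervalsIn (m n) (CurieWeiss.closedBox a b),
        ENNReal.ofReal
          |(P n).real {ω | CurieWeiss.rescaledMagnetization (X n ω) ∈ I} /
              (multivariateGaussian 0 C).real I - 1|)
      atTop (𝓝 0) := by
  have hα0 (δ : Fin d) : 0 ≤ α δ := ge_of_tendsto' (hα δ) fun n => by positivity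
  have hα1 : ∑ δ, α δ = 1 := by
    refine tendsto_nhds_unique (tendsto_finsetSum _ fun δ _ => hα δ) ?_
    refine tendsto_const_nhds.congr' ?_
    filter_upwards [eventually_ge_atTop d, eventually_gt_atTop 0] with n hn hn0
    rw [← Finset.sum_div]
    have h : ∑ δ, (N n δ : ℝ) = n := by exact_mod_cast hN_sum n hn
    have hn0' : (n : ℝ) ≠ 0 := by exact_mod_cast hn0.ne'
    rw [h, div_self hn0']
  rw [ENNReal.tendsto_nhds_zero]
  intro ε hε
  rcases eq_or_ne ε ⊤ with rfl | hεt
  · exact Eventually.of_forall fun _ => le_top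
  have hε' : 0 < ε.toReal := ENNReal.toReal_pos hε.ne' hεt
  -- These are the violating boxes: admissible, but with relative error above `ε`.
  set good : ℕ → (Fin d → Set ℝ) → Prop := fun n K =>
    {x : EuclideanSpace ℝ (Fin d) | ∀ δ, x δ ∈ K δ} ⊆ CurieWeiss.closedBox a b ∧
    (∀ δ, (K δ).OrdConnected ∧ ENNReal.ofReal (m n δ) ≤ volume (K δ)) ∧
    ε.toReal < |(P n).real {ω | CurieWeiss.rescaledMagnetization (X n ω) ∈
        {x : EuclideanSpace ℝ (Fin d) | ∀ δ, x δ ∈ K δ}} /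
      (multivariateGaussian 0 C).real {x | ∀ δ, x δ ∈ K δ} - 1| with hgood
  suffices hno : ∀ᶠ n in atTop, ∀ K, ¬ good n K by
    filter_upwards [hno] with n hn
    refine iSup₂_le fun I hI => ?_
    obtain ⟨hI1, K, hI2, rfl⟩ := hI
    rw [ENNReal.ofReal_le_iff_le_toReal hεt]
    by_contra! hlt
    exact hn K ⟨hI1, hI2, hlt⟩
  set T : Set ℕ := {n | ∃ K, good n K} with hT
  have hex : ∀ n, ∃ K, n ∈ T → good n K := fun n => by
    by_cases h : n ∈ T
    · exact ⟨h.choose, fun _ => h.choose_spec⟩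
    · exact ⟨fun _ => ∅, fun h' => absurd h' h⟩
  choose K hKgood using hex
  -- Convergence is studied only along indices with a violating box. This filter may be trivial;
  -- deriving `False` eventually along it says exactly that `T` misses all large `n`.
  set l : Filter ℕ := atTop ⊓ 𝓟 T with hl
  have hlT : ∀ᶠ n in l, n ∈ T := mem_inf_of_right (mem_principal_self T)
  have hle : l ≤ atTop := inf_le_left
  have hm0 : ∀ᶠ n in l, ∀ δ, 0 < m n δ := by
    refine (eventually_all.2 fun δ => ?_).filter_mono hle
    filter_upwards [(hm δ).eventually_gt_atTop 0] with n hn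
    exact pos_of_mul_pos_left hn (Real.sqrt_nonneg _)
  have hKb : ∀ᶠ n in l, ∀ δ, Set.Ioo (sInf (K n δ)) (sSup (K n δ)) ⊆ K n δ ∧
      K n δ ⊆ Set.Icc (sInf (K n δ)) (sSup (K n δ)) ∧ a δ ≤ sInf (K n δ) ∧ sSup (K n δ) ≤ b δ ∧
      m n δ ≤ sSup (K n δ) - sInf (K n δ) := by
    filter_upwards [hlT, hm0] with n h1 h2 δ
    have h3 := hKgood n h1
    refine CurieWeiss.ordConnected_bounds (h3.2.1 δ).1
      (CurieWeiss.subset_Icc_of_subset_closedBox h3.1 (fun γ => ?_) δ) (h2 δ) (h3.2.1 δ).2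
    rw [Set.nonempty_iff_ne_empty]
    intro h4
    have h5 := (h3.2.1 γ).2
    rw [h4] at h5
    simp [(h2 γ).not_ge] at h5
  -- A fraction `α δ` may be zero, so growth comes from `m`: along `l` a box of side at least `m n
  -- δ` fits into `[a, b]`, so `m` is bounded above and `m * √N → ∞` forces `N → ∞`. Along `atTop`
  -- alone this could fail.
  have hN : ∀ δ, Tendsto (fun n => N n δ) l atTop := fun δ => by
    rw [← tendsto_natCast_atTop_iff (R := ℝ)]
    have hba : 0 < b δ - a δ := sub_pos.2 (hab δ)
    refine tendsto_atTop_mono' l ?_ (((hm δ).mono_left hle).atTop_div_const hba)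
    filter_upwards [hKb] with n hn
    have h1 : m n δ ≤ b δ - a δ := by linarith [(hn δ).2.2.1, (hn δ).2.2.2.1, (hn δ).2.2.2.2]
    have h2 : √(N n δ : ℝ) ≤ N n δ := by
      rw [Real.sqrt_le_iff]
      refine ⟨Nat.cast_nonneg _, ?_⟩
      exact_mod_cast Nat.le_self_pow two_ne_zero (N n δ)
    rw [div_le_iff₀ hba]
    calc m n δ * √(N n δ : ℝ) ≤ (b δ - a δ) * N n δ := by gcongr
      _ = _ := mul_comm _ _
  have hr : ∀ δ, Tendsto (fun n => CurieWeiss.sqrtFraction (N n) δ) l (𝓝 √(α δ)) := fun δ => by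
    refine (((hα δ).sqrt).congr' ?_).mono_left hle
    filter_upwards [eventually_ge_atTop d] with n hn
    rw [CurieWeiss.sqrtFraction, hN_sum n hn]
  have hr1 : ∀ δ, |√(α δ)| ≤ 1 := fun δ => by
    rw [abs_of_nonneg (Real.sqrt_nonneg _), Real.sqrt_le_one, ← hα1]
    exact Finset.single_le_sum (fun δ _ => hα0 δ) (Finset.mem_univ δ)
  set R : ℝ := ∑ δ, (|a δ| + |b δ|) with hR
  have hRab (δ : Fin d) : |a δ| + |b δ| ≤ R :=
    Finset.single_le_sum (f := fun δ => |a δ| + |b δ|) (fun _ _ => by positivity)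
      (Finset.mem_univ δ)
  have key := CurieWeiss.tendsto_curieWeissMeasure_div (l := l) (N := N) (r := fun δ => √(α δ))
    (J := J) (lo := fun n δ => sInf (K n δ)) (L := fun n δ => sSup (K n δ) - sInf (K n δ))
    (K := K) (R := R) hN hr hr1 hJC.posDef (hJC.mul_eq_one hα0 hα1)
    (CurieWeiss.scaledForm_sqrt_eq J α)
    (by
      filter_upwards [hKb, hm0] with n h1 h2 δ
      have h3 := h1 δ
      have h4 := hRab δ
      have h5 := neg_abs_le (a δ)
      have h6 := le_abs_self (b δ)
      have h7 := abs_nonneg (a δ)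
      have h8 := abs_nonneg (b δ)
      exact ⟨(h2 δ).trans_le h3.2.2.2.2, by linarith [h3.2.2.1], by linarith [h3.2.2.2.1]⟩)
    (fun δ => by
      refine tendsto_atTop_mono' l ?_ ((hm δ).mono_left hle)
      filter_upwards [hKb] with n h1
      exact mul_le_mul_of_nonneg_right (h1 δ).2.2.2.2 (Real.sqrt_nonneg _))
    (by
      filter_upwards [hKb] with n h1 δ
      rw [add_sub_cancel]
      exact (h1 δ).1)
    (by
      filter_upwards [hKb] with n h1 δ
      rw [add_sub_cancel]
      exact (h1 δ).2.1)
    (by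
      filter_upwards [hlT] with n h1 δ
      exact ((hKgood n h1).2.1 δ).1.measurableSet)
  have hbot : ∀ᶠ n in l, False := by
    filter_upwards [Metric.tendsto_nhds.1 key _ hε', hlT,
      (eventually_ge_atTop d).filter_mono hle] with n h1 h2 h3
    have h4 := (hKgood n h2).2.2
    rw [Real.dist_eq] at h1
    rw [(hX n h3).measureReal_eq (p := fun x => CurieWeiss.rescaledMagnetization x ∈
        {x : EuclideanSpace ℝ (Fin d) | ∀ δ, x δ ∈ K n δ}) (Set.toFinite _).measurableSet] at h4
    exact lt_asymm h1 h4
  rw [hl, eventually_inf_principal] at hbot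
  filter_upwards [hbot] with n hn K' hK'
  exact hn ⟨K', hK'⟩
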